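/- For complex numbers $z_1,\dots,z_n$ (repetitions allowed) let $\rho_n(z)=\sum_{k=1}^n \frac{1}{z-z_k}$ be the simple partial fraction of order $n$ with these poles, and put $Y(\rho_n)=\min_{1\le k\le n}|\operatorname{Im} z_k|$. Let $$d_n(\mathbb R,\infty)=\inf\{\,Y(\rho_n):\ \|\rho_n\|_{L_\infty(\mathbb R)}=1\,\},$$ where the infimum is over the simple partial fractions of order $n$ without poles on $\mathbb R$. Let also $$d_n^{H}(\mathbb R,\infty)=\inf\{\,Y(\rho_n):\ \|\rho_n+f\|_{L_\infty(\mathbb R)}\le 1\,\},$$ where the infimum is over all simple partial fractions $\rho_n$ of order $n$ whose poles all lie in the upper half-plane $\mathbb C^+=\{\operatorname{Im} z>0\}$ and all bounded analytic functions $f$ on $\mathbb C^+$, the values of $f$ on $\mathbb R$ being its nontangential limits, which exist almost everywhere. Then each of the two quantities $d_n\in\{d_n(\mathbb R,\infty),\,d_n^{H}(\mathbb R,\infty)\}$ satisfies $$d_n\asymp\frac{\ln\ln n}{\ln n},$$ that is, there are absolute constants $a,b>0$ with $a\,\frac{\ln\ln n}{\ln n}\le d_n\le b\,\frac{\ln\ln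 n}{\ln n}$ for all $n\ge 3$. More precisely, there is $n_0$ such that $$\frac19\cdot\frac{\ln\ln n}{\ln n}\ \le\ d_n\ \le\ 2\cdot\frac{\ln\ln n}{\ln n}\qquad\text{for all } n\ge n_0 .$$ -/

import Mathlib

open MeasureTheory Filter Topology

noncomputable section

namespace Gorin

/-- The simple partial fraction `ρ(w) = ∑ₖ 1 / (w - zₖ)` of order `n` with (not necessarily
distinct) poles `z₁, …, zₙ`. -/
def simpleFraction {n : ℕ} (z : Fin n → ℂ) (w : ℂ) : ℂ :=
  ∑ k, 1 / (w - z k)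

/-- `Y(ρ) = minₖ |Im zₖ|` (used for `n ≥ 1`, where the infimum is a minimum). -/
def minAbsIm {n : ℕ} (z : Fin n → ℂ) : ℝ :=
  ⨅ k, |(z k).im|

/-- Gorin's quantity `d_n(ℝ, ∞)`: the infimum of `Y(ρ)` over the simple partial fractions of
order `n` without real poles whose norm in `L_∞(ℝ)` is `1`. -/
def gorinDist (n : ℕ) : ℝ :=
  sInf {y : ℝ | ∃ z : Fin n → ℂ, (∀ k, (z k).im ≠ 0) ∧
    eLpNorm (fun x : ℝ => simpleFraction z (x : ℂ)) ⊤ volume = 1 ∧ y = minAbsIm z}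

/-- The Hardy space `H_∞` of bounded analytic functions on the open upper half-plane (only the
values of `f` there matter). -/
def IsHInfty (f : ℂ → ℂ) : Prop :=
  DifferentiableOn ℂ f {w : ℂ | 0 < w.im} ∧ ∃ M : ℝ, ∀ w : ℂ, 0 < w.im → ‖f w‖ ≤ M

/-- For `α > 0`, the open angle in the upper half-plane with vertex at the real point `x`. -/
def angleAt (x α : ℝ) : Set ℂ :=
  {w : ℂ | |w.re - x| < α * w.im}

/-- `g` is the boundary function of `f`: at almost every real point `x`, the value `g x` is the
nontangential limit of `f` from the upper half-plane. -/
def IsBoundaryFunction (f : ℂ → ℂ) (g : ℝ → ℂ) : Prop :=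
  ∀ᵐ x : ℝ, ∀ α : ℝ, 0 < α → Tendsto f (𝓝[angleAt x α] (x : ℂ)) (𝓝 (g x))

/-- The variant of Gorin's quantity in which the simple partial fractions have all their poles in
the upper half-plane and may be corrected by a function `f ∈ H_∞`: the infimum of `Y(ρ)` over all
`ρ + f` whose norm in `L_∞(ℝ)` is at most `1`, where `f` is understood on `ℝ` through its
nontangential limits. -/
def gorinHardyDist (n : ℕ) : ℝ :=
  sInf {y : ℝ | ∃ z : Fin n → ℂ, (∀ k, 0 < (z k).im) ∧
    (∃ (f : ℂ → ℂ) (g : ℝ → ℂ), IsHInfty f ∧ IsBoundaryFunction f g ∧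
      eLpNorm (fun x : ℝ => simpleFraction z (x : ℂ) + g x) ⊤ volume ≤ 1) ∧
    y = minAbsIm z}

/-- `ln ln n / ln n`. -/
def rate (n : ℕ) : ℝ :=
  Real.log (Real.log n) / Real.log n

end Gorin

end

noncomputable section

namespace Gorin

/-! ### Cauchy's theorem for the upper half-plane with almost everywhere boundary values -/

/-! Lower bound. Poles below the real line contribute a bounded analytic function on the upper
half-plane, so, after a conjugation if necessary, both quantities reduce to `F = ρ + f` with the
poles of `ρ` above the line and `|F| ≤ 1` almost everywhere on it. Multiplied by the Blaschke
product `B` of the poles, `F` becomes bounded analytic, and the maximum principle gives `|F| ≤ 1 /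
|B|` (`norm_blaschke_mul_le_one`). Integrating `F` over a circle of radius `σ h` about the lowest
pole `z₀`, of height `h`, yields `1 ≤ σ h max |F|` (`one_le_radius_mul`). A radius chosen by
averaging (`exists_good_radius`) bounds `log (1 / |B|)` there by `22 h` times a Poisson-type sum
over the poles, seen from the reflection of `z₀` (`neg_log_im_le`). Pairing `F` with a test function
having two simple poles below the line bounds that sum by `O(1 + log (n / h))` (`sum_kernel_le`).
Altogether `-log h ≤ 50 + (33/4) h log n`, which forces `h ≥ (1/9) log log n / log n` for large `n`.

Upper bound. Let `P` have the zeros `i, …, mi` and `P*` the zeros `-i, …, -mi`. The zeros of `Q = P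
- δ P*` with `|δ| < 1` lie in the upper half-plane. On the real line `Q'/Q + P*'/P*` differs from
`P'/P + P*'/P*`, which is at most `π` in modulus, by a term of size `O(|δ| log m)`
(`norm_sum_roots_add_le`). For `|δ|` a small multiple of `1 / log n` this term is small, yet `Q`
still has a zero on the imaginary axis at height about `log (1/|δ|) / (2 log m)`
(`exists_low_root`). The choice `m = n / 2`, distant poles to reach order `n` and a rescaling finish
the construction; the constant `2` leaves room over `π / 2`. -/

lemma isOpen_upper : IsOpen {w : ℂ | 0 < w.im} :=
  isOpen_lt continuous_const Complex.continuous_im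

/-- The point `x + i t`. -/
def pt (x t : ℝ) : ℂ := (x : ℂ) + (t : ℂ) * Complex.I

@[simp] lemma pt_re (x t : ℝ) : (pt x t).re = x := by simp [pt]

@[simp] lemma pt_im (x t : ℝ) : (pt x t).im = t := by simp [pt]

lemma pt_zero (x : ℝ) : pt x 0 = x := by simp [pt]

lemma norm_pt_sq (x t : ℝ) : ‖pt x t‖ ^ 2 = x ^ 2 + t ^ 2 := by
  rw [Complex.sq_norm, Complex.normSq_apply]; simp; ring

lemma tendsto_pt (x : ℝ) : Tendsto (fun t => pt x t) (𝓝 0) (𝓝 (x : ℂ)) := by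
  have : Continuous fun t => pt x t := by unfold pt; fun_prop
  simpa [pt_zero] using this.tendsto 0

lemma decay_le {C x t : ℝ} (hC : 0 ≤ C) :
    C * (1 + ‖pt x t‖ ^ 2)⁻¹ ≤ C * (1 + x ^ 2)⁻¹ := by
  rw [norm_pt_sq]
  gcongr
  nlinarith [sq_nonneg t]

lemma continuous_line {Φ : ℂ → ℂ} (hd : DifferentiableOn ℂ Φ {w : ℂ | 0 < w.im}) {t : ℝ}
    (ht : 0 < t) : Continuous fun x : ℝ => Φ (pt x t) := by
  refine hd.continuousOn.comp_continuous (by unfold pt; fun_prop) ?_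
  intro x
  simpa using ht

lemma integrable_line {Φ : ℂ → ℂ} {C : ℝ} (hC : 0 ≤ C)
    (hd : DifferentiableOn ℂ Φ {w : ℂ | 0 < w.im})
    (hb : ∀ w : ℂ, 0 < w.im → ‖Φ w‖ ≤ C * (1 + ‖w‖ ^ 2)⁻¹) {t : ℝ} (ht : 0 < t) :
    Integrable fun x : ℝ => Φ (pt x t) := by
  refine Integrable.mono' (integrable_inv_one_add_sq.const_mul C)
    (continuous_line hd ht).aestronglyMeasurable (Eventually.of_forall fun x => ?_)
  exact (hb _ (by simpa using ht)).trans (decay_le hC)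

/-- Cauchy's theorem on rectangles of half-width `R`; the decay of `Φ` kills the vertical sides as
`R → ∞`. -/
lemma integral_line_eq {Φ : ℂ → ℂ} {C : ℝ} (hC : 0 ≤ C)
    (hd : DifferentiableOn ℂ Φ {w : ℂ | 0 < w.im})
    (hb : ∀ w : ℂ, 0 < w.im → ‖Φ w‖ ≤ C * (1 + ‖w‖ ^ 2)⁻¹) {t T : ℝ} (ht : 0 < t) (hT : t ≤ T) :
    ∫ x : ℝ, Φ (pt x t) = ∫ x : ℝ, Φ (pt x T) := by
  have hT0 : 0 < T := ht.trans_le hT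
  have rect : ∀ R : ℝ, (∫ x in (-R)..R, Φ (pt x t)) - (∫ x in (-R)..R, Φ (pt x T)) =
      Complex.I * (∫ y in t..T, Φ (pt (-R) y)) - Complex.I * ∫ y in t..T, Φ (pt R y) := by
    intro R
    have := Complex.integral_boundary_rect_eq_zero_of_differentiableOn Φ (pt (-R) t) (pt R T)
      (hd.mono (by
        intro w hw
        have h2 := hw.2
        simp only [pt_im, Set.mem_preimage, Set.uIcc_of_le hT] at h2
        exact ht.trans_le h2.1))
    simp only [pt_re, pt_im, smul_eq_mul] at this
    simp only [pt] at this ⊢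
    linear_combination this
  have side : ∀ σ : ℝ, |σ| = 1 →
      Tendsto (fun R : ℝ => ∫ y in t..T, Φ (pt (σ * R) y)) atTop (𝓝 0) := by
    intro σ hσ
    have hσ2 : σ ^ 2 = 1 := by rw [← sq_abs, hσ]; norm_num
    have h0 : Tendsto (fun R : ℝ => C * (1 + R ^ 2)⁻¹ * |T - t|) atTop (𝓝 0) := by
      have : Tendsto (fun R : ℝ => (1 + R ^ 2)⁻¹) atTop (𝓝 0) :=
        tendsto_inv_atTop_zero.comp
          (tendsto_atTop_add_const_left _ _ (tendsto_pow_atTop two_ne_zero))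
      simpa using (this.const_mul C).mul_const |T - t|
    refine squeeze_zero_norm (fun R => ?_) h0
    refine intervalIntegral.norm_integral_le_of_norm_le_const fun y hy => ?_
    rw [Set.uIoc_of_le hT] at hy
    refine (hb _ (by simpa using ht.trans hy.1)).trans ((decay_le hC).trans_eq ?_)
    rw [mul_pow, hσ2, one_mul]
  have l1 := intervalIntegral_tendsto_integral (integrable_line hC hd hb ht)
    tendsto_neg_atTop_atBot tendsto_id
  have l2 := intervalIntegral_tendsto_integral (integrable_line hC hd hb hT0)
    tendsto_neg_atTop_atBot tendsto_id
  have l3 := ((side (-1) (by simp)).const_mul Complex.I).sub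
    ((side 1 (by simp)).const_mul Complex.I)
  have l4 := l1.sub l2
  simp only [id, rect] at l4
  simp only [neg_mul, one_mul, mul_zero, sub_zero] at l3
  exact sub_eq_zero.1 (tendsto_nhds_unique l4 l3)

/-- The integral does not depend on the height, and it tends to `0` by dominated convergence as the
height grows. -/
lemma integral_line_eq_zero {Φ : ℂ → ℂ} {C : ℝ} (hC : 0 ≤ C)
    (hd : DifferentiableOn ℂ Φ {w : ℂ | 0 < w.im})
    (hb : ∀ w : ℂ, 0 < w.im → ‖Φ w‖ ≤ C * (1 + ‖w‖ ^ 2)⁻¹) {t : ℝ} (ht : 0 < t) :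
    ∫ x : ℝ, Φ (pt x t) = 0 := by
  have h : Tendsto (fun T : ℝ => ∫ x : ℝ, Φ (pt x T)) atTop (𝓝 (∫ _ : ℝ, (0 : ℂ))) := by
    refine tendsto_integral_filter_of_dominated_convergence (fun x => C * (1 + x ^ 2)⁻¹) ?_ ?_
      (integrable_inv_one_add_sq.const_mul C) ?_
    · filter_upwards [eventually_gt_atTop 0] with T hT
      exact (continuous_line hd hT).aestronglyMeasurable
    · filter_upwards [eventually_gt_atTop 0] with T hT
      exact Eventually.of_forall fun x => (hb _ (by simpa using hT)).trans (decay_le hC)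
    · refine Eventually.of_forall fun x => ?_
      have h0 : Tendsto (fun R : ℝ => C * (1 + R ^ 2)⁻¹) atTop (𝓝 0) := by
        have : Tendsto (fun R : ℝ => (1 + R ^ 2)⁻¹) atTop (𝓝 0) :=
          tendsto_inv_atTop_zero.comp
            (tendsto_atTop_add_const_left _ _ (tendsto_pow_atTop two_ne_zero))
        simpa using this.const_mul C
      refine squeeze_zero_norm' ?_ h0
      filter_upwards [eventually_gt_atTop 0] with T hT
      refine (hb _ (by simpa using hT)).trans ?_
      rw [norm_pt_sq]
      gcongr
      nlinarith [sq_nonneg x]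
  have hconst : Tendsto (fun T : ℝ => ∫ x : ℝ, Φ (pt x T)) atTop (𝓝 (∫ x : ℝ, Φ (pt x t))) := by
    refine tendsto_const_nhds.congr' ?_
    filter_upwards [eventually_ge_atTop t] with T hT
    exact integral_line_eq hC hd hb ht hT
  simpa using tendsto_nhds_unique hconst h

/-- `Ψ` is almost everywhere the vertical limit of `Φ`. -/
def HasVerticalLimit (Φ : ℂ → ℂ) (Ψ : ℝ → ℂ) : Prop :=
  ∀ᵐ x : ℝ, Tendsto (fun t : ℝ => Φ (pt x t)) (𝓝[>] 0) (𝓝 (Ψ x))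

/-- Cauchy's theorem for the upper half-plane. -/
lemma integral_boundary_eq_zero {Φ : ℂ → ℂ} {Ψ : ℝ → ℂ} {C : ℝ} (hC : 0 ≤ C)
    (hd : DifferentiableOn ℂ Φ {w : ℂ | 0 < w.im})
    (hb : ∀ w : ℂ, 0 < w.im → ‖Φ w‖ ≤ C * (1 + ‖w‖ ^ 2)⁻¹) (hl : HasVerticalLimit Φ Ψ) :
    ∫ x : ℝ, Ψ x = 0 := by
  have h : Tendsto (fun t : ℝ => ∫ x : ℝ, Φ (pt x t)) (𝓝[>] 0) (𝓝 (∫ x : ℝ, Ψ x)) := by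
    refine tendsto_integral_filter_of_dominated_convergence (fun x => C * (1 + x ^ 2)⁻¹) ?_ ?_
      (integrable_inv_one_add_sq.const_mul C) hl
    · filter_upwards [self_mem_nhdsWithin] with T hT
      exact (continuous_line hd hT).aestronglyMeasurable
    · filter_upwards [self_mem_nhdsWithin] with T hT
      exact Eventually.of_forall fun x =>
        (hb _ (by simpa using hT)).trans (decay_le hC)
  refine tendsto_nhds_unique h (tendsto_const_nhds.congr' ?_)
  filter_upwards [self_mem_nhdsWithin] with T hT
  exact (integral_line_eq_zero hC hd hb hT).symm

lemma HasVerticalLimit.integrable {Φ : ℂ → ℂ} {Ψ : ℝ → ℂ} {C : ℝ} (hC : 0 ≤ C)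
    (hd : DifferentiableOn ℂ Φ {w : ℂ | 0 < w.im})
    (hb : ∀ w : ℂ, 0 < w.im → ‖Φ w‖ ≤ C * (1 + ‖w‖ ^ 2)⁻¹) (hl : HasVerticalLimit Φ Ψ) :
    Integrable Ψ := by
  have hu : Tendsto (fun m : ℕ => 1 / ((m : ℝ) + 1)) atTop (𝓝[>] 0) :=
    tendsto_nhdsWithin_iff.2 ⟨tendsto_one_div_add_atTop_nhds_zero_nat,
      Eventually.of_forall fun m => by simp only [Set.mem_Ioi]; positivity⟩
  refine Integrable.mono' (integrable_inv_one_add_sq.const_mul C) ?_ ?_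
  · refine aestronglyMeasurable_of_tendsto_ae atTop
      (f := fun m : ℕ => fun x => Φ (pt x (1 / ((m : ℝ) + 1)))) (fun m => ?_) ?_
    · exact (continuous_line hd (by positivity)).aestronglyMeasurable
    · filter_upwards [hl] with x hx
      exact hx.comp hu
  · filter_upwards [hl] with x hx
    refine le_of_tendsto hx.norm ?_
    filter_upwards [self_mem_nhdsWithin] with T hT
    exact (hb _ (by simpa using hT)).trans (decay_le hC)

lemma ne_ofReal_of_im_pos {a : ℂ} (ha : 0 < a.im) (x : ℝ) : (x : ℂ) - a ≠ 0 := by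
  intro h
  have := congrArg Complex.im h
  simp at this
  exact ha.ne' this

lemma sub_conj_ne_zero {a w : ℂ} (ha : 0 < a.im) (hw : 0 ≤ w.im) :
    w - (starRingEnd ℂ) a ≠ 0 := by
  intro h
  have := congrArg Complex.im h
  simp at this
  linarith

/-- `π` times the Poisson kernel of the upper half-plane. -/
def poissonKernel (a : ℂ) (x : ℝ) : ℝ := a.im⁻¹ * (1 + ((x - a.re) / a.im) ^ 2)⁻¹

lemma poissonKernel_nonneg {a : ℂ} (ha : 0 < a.im) (x : ℝ) : 0 ≤ poissonKernel a x := by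
  unfold poissonKernel; positivity

lemma integral_poissonKernel {a : ℂ} (ha : 0 < a.im) : ∫ x : ℝ, poissonKernel a x = Real.pi := by
  unfold poissonKernel
  rw [integral_const_mul, integral_sub_right_eq_self (fun x => (1 + (x / a.im) ^ 2)⁻¹) a.re,
    Measure.integral_comp_div (fun x => (1 + x ^ 2)⁻¹), integral_univ_inv_one_add_sq,
    smul_eq_mul, abs_of_pos ha, inv_mul_cancel_left₀ ha.ne']

lemma integrable_poissonKernel {a : ℂ} (ha : 0 < a.im) : Integrable (poissonKernel a) := by
  -- A non-integrable function has integral `0` by convention, so a nonzero value already proves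
  -- integrability.
  by_contra h
  have := integral_poissonKernel ha
  rw [integral_undef h] at this
  exact Real.pi_ne_zero this.symm

/-- The factor `(a - ā) / (w - ā)` equals `1` at `a` and decays at infinity; with it the Cauchy
kernel becomes a positive kernel of known mass. -/
lemma kernel_eq_poissonKernel {a : ℂ} (ha : 0 < a.im) (x : ℝ) :
    (a - (starRingEnd ℂ) a) / (x - (starRingEnd ℂ) a) / ((x : ℂ) - a) =
      2 * Complex.I * (poissonKernel a x : ℂ) := by
  have e1 : ((x : ℂ) - (starRingEnd ℂ) a) * (x - a) =
      (((x - a.re) ^ 2 + a.im ^ 2 : ℝ) : ℂ) := by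
    have : (x : ℂ) - (starRingEnd ℂ) a = (starRingEnd ℂ) ((x : ℂ) - a) := by simp
    rw [this, mul_comm, Complex.mul_conj, Complex.normSq_apply]
    simp; ring
  rw [div_div, e1, Complex.sub_conj]
  have : poissonKernel a x = a.im / ((x - a.re) ^ 2 + a.im ^ 2) := by
    have : 0 < (x - a.re) ^ 2 + a.im ^ 2 := by positivity
    unfold poissonKernel
    field_simp
    ring
  rw [this]
  push_cast
  ring

/-! ### Cauchy's formula and the maximum principle -/

lemma one_add_norm_le {b w : ℂ} {r : ℝ} (hr : 0 < r) (h : r ≤ ‖w - b‖) :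
    1 + ‖w‖ ≤ ((1 + ‖b‖) / r + 1) * ‖w - b‖ := by
  have h1 : ‖w‖ ≤ ‖w - b‖ + ‖b‖ := by simpa using norm_add_le (w - b) b
  have h2 : 1 + ‖b‖ ≤ (1 + ‖b‖) / r * ‖w - b‖ := by
    rw [div_mul_eq_mul_div, le_div_iff₀ hr]
    gcongr
  linarith

lemma norm_inv_sub_le {b w : ℂ} {r : ℝ} (hr : 0 < r) (h : r ≤ ‖w - b‖) :
    ‖w - b‖⁻¹ ≤ ((1 + ‖b‖) / r + 1) * (1 + ‖w‖)⁻¹ := by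
  have h1 := one_add_norm_le hr h
  have h2 : 0 < ‖w - b‖ := hr.trans_le h
  rw [← div_eq_mul_inv, le_div_iff₀ (by positivity), inv_mul_le_iff₀ h2, mul_comm]
  linarith

lemma im_le_norm_sub_conj {a w : ℂ} (hw : 0 ≤ w.im) : a.im ≤ ‖w - (starRingEnd ℂ) a‖ := by
  have := Complex.abs_im_le_norm (w - (starRingEnd ℂ) a)
  simp at this
  linarith [le_abs_self (w.im + a.im)]

lemma tendsto_ofReal_sub_pt (x : ℝ) (b : ℂ) :
    Tendsto (fun t => pt x t - b) (𝓝[>] 0) (𝓝 ((x : ℂ) - b)) :=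
  ((tendsto_pt x).mono_left nhdsWithin_le_nhds).sub_const b

/-- Cauchy's formula in the upper half-plane. -/
lemma cauchy_formula {φ : ℂ → ℂ} {ψ : ℝ → ℂ} {K : ℝ} (hK : 0 ≤ K)
    (hd : DifferentiableOn ℂ φ {w : ℂ | 0 < w.im})
    (hb : ∀ w : ℂ, 0 < w.im → ‖φ w‖ ≤ K * (1 + ‖w‖)⁻¹) (hl : HasVerticalLimit φ ψ)
    {a : ℂ} (ha : 0 < a.im) :
    Integrable (fun x : ℝ => ψ x / (x - a)) ∧
      ∫ x : ℝ, ψ x / (x - a) = 2 * Real.pi * Complex.I * φ a := by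
  set a' := (starRingEnd ℂ) a with ha'
  -- The subtracted function is analytic above the line and agrees with `φ` at `a`. Hence `χ w / (w
  -- - a)` has a removable singularity and quadratic decay, and Cauchy's theorem applies to it.
  set χ : ℂ → ℂ := fun w => φ w - φ a * ((a - a') / (w - a')) with hχ
  have haa : a - a' ≠ 0 := sub_conj_ne_zero ha ha.le
  have hχa : χ a = 0 := by simp [hχ, div_self haa]
  have hχd : DifferentiableOn ℂ χ {w : ℂ | 0 < w.im} := by
    refine hd.sub (DifferentiableOn.const_mul ?_ _)
    refine (differentiableOn_const _).div (by fun_prop) ?_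
    intro w hw
    exact sub_conj_ne_zero ha (le_of_lt hw)
  have hnhds : {w : ℂ | 0 < w.im} ∈ 𝓝 a := isOpen_upper.mem_nhds ha
  have hDd : DifferentiableOn ℂ (dslope χ a) {w : ℂ | 0 < w.im} :=
    (Complex.differentiableOn_dslope hnhds).2 hχd
  have hDeq : ∀ w, w ≠ a → dslope χ a w = χ w / (w - a) := by
    intro w hw
    rw [dslope_of_ne _ hw, slope_def_field, hχa, sub_zero]
  set K' := K + ‖φ a‖ * ‖a - a'‖ * ((1 + ‖a'‖) / a.im + 1) with hK'
  have hK'0 : 0 ≤ K' := by positivity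
  have hχb : ∀ w : ℂ, 0 < w.im → ‖χ w‖ ≤ K' * (1 + ‖w‖)⁻¹ := by
    intro w hw
    have h1 := norm_inv_sub_le ha (im_le_norm_sub_conj (a := a) hw.le)
    calc ‖χ w‖ ≤ ‖φ w‖ + ‖φ a * ((a - a') / (w - a'))‖ := norm_sub_le _ _
      _ = ‖φ w‖ + ‖φ a‖ * ‖a - a'‖ * ‖w - a'‖⁻¹ := by
        rw [norm_mul, norm_div]; ring
      _ ≤ K * (1 + ‖w‖)⁻¹ +
          ‖φ a‖ * ‖a - a'‖ * (((1 + ‖a'‖) / a.im + 1) * (1 + ‖w‖)⁻¹) := by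
        gcongr
        exact hb w hw
      _ = K' * (1 + ‖w‖)⁻¹ := by rw [hK']; ring
  set r := a.im / 2 with hr
  have hr0 : 0 < r := by positivity
  have hsub : Metric.closedBall a r ⊆ {w : ℂ | 0 < w.im} := by
    intro w hw
    rw [mem_closedBall_iff_norm] at hw
    have := (Complex.abs_im_le_norm (w - a)).trans hw
    simp only [Complex.sub_im, abs_le] at this
    change 0 < w.im
    linarith
  obtain ⟨M, hM⟩ := (isCompact_closedBall a r).exists_bound_of_continuousOn
    (hDd.continuousOn.mono hsub)
  have hM0 : 0 ≤ M := (norm_nonneg _).trans (hM a (Metric.mem_closedBall_self hr0.le))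
  set C := K' * ((1 + ‖a‖) / r + 1) + M * (1 + (‖a‖ + r) ^ 2) with hC
  have hC0 : 0 ≤ C := by positivity
  have hDb : ∀ w : ℂ, 0 < w.im → ‖dslope χ a w‖ ≤ C * (1 + ‖w‖ ^ 2)⁻¹ := by
    intro w hw
    by_cases hwr : ‖w - a‖ ≤ r
    · have h1 := hM w (mem_closedBall_iff_norm.2 hwr)
      have h2 : ‖w‖ ≤ ‖a‖ + r := by
        have : ‖w‖ ≤ ‖w - a‖ + ‖a‖ := by simpa using norm_add_le (w - a) a
        linarith
      rw [← div_eq_mul_inv, le_div_iff₀ (by positivity)]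
      calc ‖dslope χ a w‖ * (1 + ‖w‖ ^ 2) ≤ M * (1 + (‖a‖ + r) ^ 2) := by gcongr
        _ ≤ C := by rw [hC]; linarith [show 0 ≤ K' * ((1 + ‖a‖) / r + 1) by positivity]
    · push Not at hwr
      have hwa : w ≠ a := by
        rintro rfl
        simp at hwr
        linarith
      rw [hDeq w hwa, norm_div, div_eq_mul_inv]
      have h1 := norm_inv_sub_le hr0 hwr.le
      calc ‖χ w‖ * ‖w - a‖⁻¹
          ≤ (K' * (1 + ‖w‖)⁻¹) * (((1 + ‖a‖) / r + 1) * (1 + ‖w‖)⁻¹) := by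
            gcongr
            exact hχb w hw
        _ = K' * ((1 + ‖a‖) / r + 1) * ((1 + ‖w‖) * (1 + ‖w‖))⁻¹ := by
            rw [mul_inv]; ring
        _ ≤ C * (1 + ‖w‖ ^ 2)⁻¹ := by
            gcongr
            · rw [hC]; linarith [show 0 ≤ M * (1 + (‖a‖ + r) ^ 2) by positivity]
            · nlinarith [norm_nonneg w]
  have hDl : HasVerticalLimit (dslope χ a)
      (fun x => ψ x / (x - a) - φ a * (2 * Complex.I * (poissonKernel a x : ℂ))) := by
    filter_upwards [hl] with x hx
    have hev : ∀ᶠ t in 𝓝[>] (0 : ℝ), χ (pt x t) / (pt x t - a) = dslope χ a (pt x t) := by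
      have : ∀ᶠ t in 𝓝[>] (0 : ℝ), t < a.im :=
        nhdsWithin_le_nhds (eventually_lt_nhds ha)
      filter_upwards [this] with t ht
      rw [hDeq]
      intro h
      have := congrArg Complex.im h
      simp at this
      linarith
    refine Tendsto.congr' hev ?_
    rw [← kernel_eq_poissonKernel ha x, ← mul_div_assoc, ← sub_div]
    refine Tendsto.div (hx.sub (Tendsto.const_mul _ (Tendsto.div tendsto_const_nhds
      (tendsto_ofReal_sub_pt x a') ?_))) (tendsto_ofReal_sub_pt x a) (ne_ofReal_of_im_pos ha x)
    exact sub_conj_ne_zero ha (by simp)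
  have hP : Integrable fun x : ℝ => φ a * (2 * Complex.I * (poissonKernel a x : ℂ)) :=
    ((integrable_poissonKernel ha).ofReal.const_mul _).const_mul _
  have hDi := hDl.integrable hC0 hDd hDb
  have hint : Integrable (fun x : ℝ => ψ x / (x - a)) := by
    exact (hDi.add hP).congr (Eventually.of_forall fun x => by simp)
  refine ⟨hint, ?_⟩
  have h0 := integral_boundary_eq_zero hC0 hDd hDb hDl
  rw [integral_sub hint hP, integral_const_mul, integral_const_mul,
    integral_complex_ofReal, integral_poissonKernel ha] at h0
  linear_combination h0

/-- The maximum principle for bounded analytic functions in the upper half-plane. -/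
lemma norm_le_one_of_boundary {G : ℂ → ℂ} {g : ℝ → ℂ} {M : ℝ}
    (hd : DifferentiableOn ℂ G {w : ℂ | 0 < w.im}) (hb : ∀ w : ℂ, 0 < w.im → ‖G w‖ ≤ M)
    (hl : HasVerticalLimit G g) (hg : ∀ᵐ x : ℝ, ‖g x‖ ≤ 1) {a : ℂ} (ha : 0 < a.im) :
    ‖G a‖ ≤ 1 := by
  set a' := (starRingEnd ℂ) a with ha'
  have hM : 0 ≤ M := (norm_nonneg _).trans (hb a ha)
  have haa : a - a' ≠ 0 := sub_conj_ne_zero ha ha.le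
  -- `G` alone need not decay; the extra factor supplies the decay without changing the value at
  -- `a`.
  have key := cauchy_formula (φ := fun w => G w * ((a - a') / (w - a')))
    (ψ := fun x => g x * ((a - a') / (x - a')))
    (K := M * ‖a - a'‖ * ((1 + ‖a'‖) / a.im + 1)) (by positivity)
    (by
      refine hd.mul ((differentiableOn_const _).div (by fun_prop) ?_)
      intro w hw
      exact sub_conj_ne_zero ha (le_of_lt hw))
    (by
      intro w hw
      have h1 := norm_inv_sub_le ha (im_le_norm_sub_conj (a := a) hw.le)
      rw [norm_mul, norm_div, div_eq_mul_inv]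
      calc ‖G w‖ * (‖a - a'‖ * ‖w - a'‖⁻¹)
          ≤ M * (‖a - a'‖ * (((1 + ‖a'‖) / a.im + 1) * (1 + ‖w‖)⁻¹)) := by
            gcongr
            exact hb w hw
        _ = _ := by ring)
    (by
      filter_upwards [hl] with x hx
      exact hx.mul (Tendsto.div tendsto_const_nhds (tendsto_ofReal_sub_pt x a')
        (sub_conj_ne_zero ha (by simp)))) ha
  have h2 := key.2
  simp only [div_self haa, mul_one] at h2
  have h3 : ‖∫ x : ℝ, g x * ((a - a') / (x - a')) / (x - a)‖ ≤
      ∫ x : ℝ, 2 * poissonKernel a x := by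
    refine norm_integral_le_of_norm_le ((integrable_poissonKernel ha).const_mul 2) ?_
    filter_upwards [hg] with x hx
    rw [mul_div_assoc, kernel_eq_poissonKernel ha x, norm_mul]
    have : ‖2 * Complex.I * (poissonKernel a x : ℂ)‖ = 2 * poissonKernel a x := by
      simp [abs_of_nonneg (poissonKernel_nonneg ha x)]
    rw [this]
    exact mul_le_of_le_one_left (mul_nonneg zero_le_two (poissonKernel_nonneg ha x)) hx
  rw [h2, integral_const_mul, integral_poissonKernel ha, norm_mul] at h3
  have h4 : ‖(2 * Real.pi * Complex.I : ℂ)‖ = 2 * Real.pi := by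
    simp [abs_of_pos Real.pi_pos]
  rw [h4] at h3
  have := Real.pi_pos
  nlinarith

/-! ### Duality with test functions -/

section Duality

variable {ι : Type*} [Fintype ι] {z : ι → ℂ} {f : ℂ → ℂ} {g : ℝ → ℂ}

/-- Integrate `(ρ + f) φ` over the line: each pole contributes `2πi φ(zₖ)` by Cauchy's formula, and
`f φ` integrates to `0`. -/
lemma norm_sum_testFunction_le (hz : ∀ k, 0 < (z k).im) (hf : IsHInfty f)
    (hg : HasVerticalLimit f g) (h1 : ∀ᵐ x : ℝ, ‖∑ k, 1 / ((x : ℂ) - z k) + g x‖ ≤ 1)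
    {φ : ℂ → ℂ} {ψ : ℝ → ℂ} {K : ℝ} (hK : 0 ≤ K)
    (hd : DifferentiableOn ℂ φ {w : ℂ | 0 < w.im})
    (hb : ∀ w : ℂ, 0 < w.im → ‖φ w‖ ≤ K * (1 + ‖w‖ ^ 2)⁻¹) (hl : HasVerticalLimit φ ψ) :
    2 * Real.pi * ‖∑ k, φ (z k)‖ ≤ ∫ x : ℝ, ‖ψ x‖ := by
  obtain ⟨hfd, M, hM⟩ := hf
  have hM' : ∀ w : ℂ, 0 < w.im → ‖f w‖ ≤ |M| := fun w hw => (hM w hw).trans (le_abs_self M)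
  have hψ := hl.integrable hK hd hb
  have hb' : ∀ w : ℂ, 0 < w.im → ‖φ w‖ ≤ (2 * K) * (1 + ‖w‖)⁻¹ := by
    intro w hw
    refine (hb w hw).trans ?_
    rw [mul_comm 2 K, mul_assoc]
    gcongr
    rw [← div_eq_mul_inv, le_div_iff₀ (by positivity), inv_mul_le_iff₀ (by positivity)]
    nlinarith [sq_nonneg (‖w‖ - 1), sq_nonneg ‖w‖]
  have hk : ∀ k, Integrable (fun x : ℝ => ψ x / (x - z k)) ∧
      ∫ x : ℝ, ψ x / (x - z k) = 2 * Real.pi * Complex.I * φ (z k) := fun k =>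
    cauchy_formula (by positivity) hd hb' hl (hz k)
  have hfφd : DifferentiableOn ℂ (fun w => f w * φ w) {w : ℂ | 0 < w.im} := hfd.mul hd
  have hfφb : ∀ w : ℂ, 0 < w.im → ‖f w * φ w‖ ≤ |M| * K * (1 + ‖w‖ ^ 2)⁻¹ := by
    intro w hw
    rw [norm_mul, mul_assoc]
    exact mul_le_mul (hM' w hw) (hb w hw) (norm_nonneg _) (abs_nonneg M)
  have hfφl : HasVerticalLimit (fun w => f w * φ w) (fun x => g x * ψ x) := by
    filter_upwards [hg, hl] with x h1 h2
    exact h1.mul h2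
  have hi := hfφl.integrable (by positivity) hfφd hfφb
  have h0 := integral_boundary_eq_zero (by positivity) hfφd hfφb hfφl
  have htot : ∫ x : ℝ, ((∑ k, 1 / ((x : ℂ) - z k)) + g x) * ψ x =
      2 * Real.pi * Complex.I * ∑ k, φ (z k) := by
    have e : ∀ x : ℝ, ((∑ k, 1 / ((x : ℂ) - z k)) + g x) * ψ x =
        (∑ k, ψ x / (x - z k)) + g x * ψ x := by
      intro x
      rw [add_mul, Finset.sum_mul]
      congr 1
      exact Finset.sum_congr rfl fun k _ => by ring
    simp_rw [e]
    rw [integral_add (integrable_finsetSum _ fun k _ => (hk k).1) hi, h0,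
      integral_finsetSum _ fun k _ => (hk k).1, add_zero, Finset.mul_sum]
    exact Finset.sum_congr rfl fun k _ => (hk k).2
  have h4 : ‖(2 * Real.pi * Complex.I : ℂ)‖ = 2 * Real.pi := by
    simp [abs_of_pos Real.pi_pos]
  rw [← h4, ← norm_mul, ← htot]
  refine norm_integral_le_of_norm_le hψ.norm ?_
  filter_upwards [h1] with x hx
  rw [norm_mul]
  exact mul_le_of_le_one_left (norm_nonneg _) hx

end Duality

/-! ### An integral estimate -/

/-- Partial fractions; `144 L - 25 h` is the determinant of the two linear factors. -/
lemma hasDerivAt_log_ratio {h L : ℝ} (hh : 0 < h) (hL : h < L) {x : ℝ} (hx : 0 ≤ x) :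
    HasDerivAt (fun x : ℝ => (Real.log (12 * x + 5 * h) - Real.log (5 * x + 12 * L)) *
        (169 / (144 * L - 25 * h)))
      (169 / ((12 * x + 5 * h) * (5 * x + 12 * L))) x := by
  have p1 : 0 < 12 * x + 5 * h := by positivity
  have p2 : 0 < 5 * x + 12 * L := by linarith
  have p3 : 0 < 144 * L - 25 * h := by linarith
  have d1 : HasDerivAt (fun x : ℝ => 12 * x + 5 * h) 12 x := by
    simpa using ((hasDerivAt_id x).const_mul 12).add_const (5 * h)
  have d2 : HasDerivAt (fun x : ℝ => 5 * x + 12 * L) 5 x := by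
    simpa using ((hasDerivAt_id x).const_mul 5).add_const (12 * L)
  refine (((d1.log p1.ne').sub (d2.log p2.ne')).mul_const (169 / (144 * L - 25 * h))).congr_deriv ?_
  rw [div_sub_div _ _ p1.ne' p2.ne', div_mul_div_comm, div_eq_div_iff (by positivity)
    (by positivity)]
  ring

lemma tendsto_log_ratio {h L : ℝ} (hh : 0 < h) (hL : h < L) :
    Tendsto (fun x : ℝ => (Real.log (12 * x + 5 * h) - Real.log (5 * x + 12 * L)) *
        (169 / (144 * L - 25 * h))) atTop
      (𝓝 (Real.log (12 / 5) * (169 / (144 * L - 25 * h)))) := by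
  refine Tendsto.mul_const _ ?_
  have t1 : Tendsto (fun x : ℝ => (12 + 5 * h / x) / (5 + 12 * L / x)) atTop
      (𝓝 ((12 + 0) / (5 + 0))) :=
    (tendsto_const_nhds.add (tendsto_const_nhds.div_atTop tendsto_id)).div
      (tendsto_const_nhds.add (tendsto_const_nhds.div_atTop tendsto_id)) (by norm_num)
  rw [add_zero, add_zero] at t1
  have t2 := (Real.continuousAt_log (show (12 / 5 : ℝ) ≠ 0 by norm_num)).tendsto.comp t1
  refine t2.congr' ?_
  filter_upwards [eventually_gt_atTop 0] with x hx
  have p1 : 0 < 12 * x + 5 * h := by positivity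
  have p2 : 0 < 5 * x + 12 * L := by nlinarith
  rw [← Real.log_div p1.ne' p2.ne']
  simp only [Function.comp]
  congr 1
  have : 0 < 5 + 12 * L / x := by
    have : 0 < L := hh.trans hL
    positivity
  field_simp

lemma integral_majorant {h L : ℝ} (hh : 0 < h) (hL : h < L) :
    ∫ x : ℝ, 169 / ((12 * |x| + 5 * h) * (5 * |x| + 12 * L)) =
      2 * (Real.log (144 * L / (25 * h)) * (169 / (144 * L - 25 * h))) := by
  have hL0 : 0 < L := hh.trans hL
  rw [integral_comp_abs (f := fun x => 169 / ((12 * x + 5 * h) * (5 * x + 12 * L))),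
    integral_Ioi_of_hasDerivAt_of_nonneg' (fun x hx => hasDerivAt_log_ratio hh hL hx)
      (fun x hx => by
        have : 0 < x := hx
        positivity) (tendsto_log_ratio hh hL)]
  have e : Real.log (144 * L / (25 * h)) =
      Real.log (12 / 5) - (Real.log (5 * h) - Real.log (12 * L)) := by
    rw [← Real.log_div (by positivity) (by positivity),
      ← Real.log_div (by norm_num) (by positivity)]
    congr 1
    field_simp
    norm_num
  rw [e]
  simp only [mul_zero, zero_add]
  ring

/-- Cauchy–Schwarz against the unit vector `(c, s)`; it replaces norms by linear expressions, whose
products integrate in closed form. -/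
lemma add_le_norm {w : ℂ} {c s p : ℝ} (hcs : c ^ 2 + s ^ 2 = 1) (hp : |w.im| = p) :
    c * |w.re| + s * p ≤ ‖w‖ := by
  rw [← Real.sqrt_sq (norm_nonneg w), Complex.sq_norm, Complex.normSq_apply]
  apply Real.le_sqrt_of_sq_le
  rw [← abs_mul_abs_self w.re, ← abs_mul_abs_self w.im, hp]
  nlinarith [sq_nonneg (s * |w.re| - c * p)]

/-- Between the scales `h` and `L` the first factor is close to `|x - x₀|` and the second to `L`.
The rational unit vectors `(12/13, 5/13)` and `(5/13, 12/13)` put the large weight on the dominant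
part, at a cost of only `169/144`. -/
lemma integral_testFunction_le {h L : ℝ} (hh : 0 < h) (hL : h < L) (x₀ : ℝ) :
    ∫ x : ℝ, ‖1 / (((x : ℂ) - pt x₀ (-h)) * (x - pt x₀ (-L)))‖ ≤
      2 * (Real.log (144 * L / (25 * h)) * (169 / (144 * L - 25 * h))) := by
  have hL0 : 0 < L := hh.trans hL
  have hpos : 0 < 2 * (Real.log (144 * L / (25 * h)) * (169 / (144 * L - 25 * h))) := by
    have : 0 < Real.log (144 * L / (25 * h)) := by
      apply Real.log_pos
      rw [lt_div_iff₀ (by positivity)]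
      linarith
    have : 0 < 144 * L - 25 * h := by linarith
    positivity
  have hint : Integrable fun x : ℝ => 169 / ((12 * |x| + 5 * h) * (5 * |x| + 12 * L)) := by
    by_contra hc
    have := integral_majorant hh hL
    rw [integral_undef hc] at this
    exact hpos.ne this
  rw [← integral_majorant hh hL,
    ← integral_sub_right_eq_self (fun x : ℝ => 169 / ((12 * |x| + 5 * h) * (5 * |x| + 12 * L))) x₀]
  refine integral_mono_of_nonneg (Eventually.of_forall fun x => norm_nonneg _)
    (hint.comp_sub_right x₀) (Eventually.of_forall fun x => ?_)
  have b1 := add_le_norm (w := (x : ℂ) - pt x₀ (-h)) (c := 12 / 13) (s := 5 / 13) (p := h)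
    (by norm_num) (by simp [abs_of_pos hh])
  have b2 := add_le_norm (w := (x : ℂ) - pt x₀ (-L)) (c := 5 / 13) (s := 12 / 13) (p := L)
    (by norm_num) (by simp [abs_of_pos hL0])
  simp only [Complex.sub_re, Complex.ofReal_re, pt_re] at b1 b2
  have p1 : 0 < 12 / 13 * |x - x₀| + 5 / 13 * h := by positivity
  have p2 : 0 < 5 / 13 * |x - x₀| + 12 / 13 * L := by positivity
  simp only [norm_div, norm_one, norm_mul]
  have := mul_le_mul b1 b2 p2.le (norm_nonneg _)
  rw [div_le_div_iff₀ (by nlinarith) (by positivity)]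
  linarith

/-! ### A Carleson-type bound for the distribution of the poles -/

section Carleson

variable {ι : Type*} [Fintype ι] {z : ι → ℂ} {f : ℂ → ℂ} {g : ℝ → ℂ}

/-- The test function `φ` has simple poles at `x₀ - ih` and `x₀ - iL`, and the real part of `-(L -
h) φ` is a difference of Poisson-type kernels. The kernel at depth `L` is at most `1 / L` per pole;
duality bounds the whole difference. -/
lemma sum_kernel_le (hz : ∀ k, 0 < (z k).im) (hf : IsHInfty f)
    (hg : HasVerticalLimit f g) (h1 : ∀ᵐ x : ℝ, ‖∑ k, 1 / ((x : ℂ) - z k) + g x‖ ≤ 1)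
    {h L : ℝ} (hh : 0 < h) (hL : h < L) (x₀ : ℝ) :
    ∑ k, ((z k).im + h) / ‖z k - pt x₀ (-h)‖ ^ 2 ≤
      Fintype.card ι / L + 169 / (144 * Real.pi) * Real.log (144 * L / (25 * h)) := by
  have hL0 : 0 < L := hh.trans hL
  have him : ∀ {p : ℝ} (w : ℂ), 0 ≤ w.im → p ≤ ‖w - pt x₀ (-p)‖ := by
    intro p w hw
    have := Complex.abs_im_le_norm (w - pt x₀ (-p))
    simp at this
    linarith [le_abs_self (w.im + p)]
  have hne : ∀ {p : ℝ}, 0 < p → ∀ w : ℂ, 0 ≤ w.im → w - pt x₀ (-p) ≠ 0 := by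
    intro p hp w hw
    exact norm_pos_iff.1 (hp.trans_le (him w hw))
  set φ : ℂ → ℂ := fun w => 1 / ((w - pt x₀ (-h)) * (w - pt x₀ (-L))) with hφ
  have key := norm_sum_testFunction_le hz hf hg h1 (φ := φ) (ψ := fun x => φ x)
    (K := ((1 + ‖pt x₀ (-h)‖) / h + 1) * ((1 + ‖pt x₀ (-L)‖) / L + 1)) (by positivity)
    (by
      refine (differentiableOn_const _).div (by fun_prop) ?_
      intro w hw
      exact mul_ne_zero (hne hh w (le_of_lt hw)) (hne hL0 w (le_of_lt hw)))
    (by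
      intro w hw
      have n1 := norm_inv_sub_le hh (him w hw.le)
      have n2 := norm_inv_sub_le hL0 (him w hw.le)
      simp only [hφ, norm_inv, norm_mul, one_div, mul_inv]
      refine (mul_le_mul n1 n2 (by positivity) (by positivity)).trans ?_
      rw [mul_mul_mul_comm, ← mul_inv]
      gcongr
      nlinarith [norm_nonneg w])
    (by
      refine Eventually.of_forall fun x => ?_
      refine Tendsto.div tendsto_const_nhds
        ((tendsto_ofReal_sub_pt x _).mul (tendsto_ofReal_sub_pt x _)) ?_
      exact mul_ne_zero (hne hh _ (by simp)) (hne hL0 _ (by simp)))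
  have hint := integral_testFunction_le hh hL x₀
  have hre : ∀ k, ((z k).im + h) / ‖z k - pt x₀ (-h)‖ ^ 2 - 1 / L ≤
      (-((L - h : ℝ) : ℂ) * φ (z k)).re := by
    intro k
    have e : -((L - h : ℝ) : ℂ) * φ (z k) =
        Complex.I / (z k - pt x₀ (-h)) - Complex.I / (z k - pt x₀ (-L)) := by
      have i1 := hne hh (z k) (hz k).le
      have i2 := hne hL0 (z k) (hz k).le
      rw [div_sub_div _ _ i1 i2, hφ]
      simp only [mul_one_div]
      congr 1
      simp only [pt]
      push_cast
      ring_nf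
      simp
    have r : ∀ p : ℝ, (Complex.I / (z k - pt x₀ (-p))).re =
        ((z k).im + p) / ‖z k - pt x₀ (-p)‖ ^ 2 := by
      intro p
      rw [Complex.div_re, Complex.sq_norm]
      simp
    rw [e, Complex.sub_re, r, r]
    have q : ((z k).im + L) / ‖z k - pt x₀ (-L)‖ ^ 2 ≤ 1 / L := by
      have n0 := Complex.abs_im_le_norm (z k - pt x₀ (-L))
      simp only [Complex.sub_im, pt_im, sub_neg_eq_add] at n0
      have p0 : 0 < (z k).im + L := add_pos (hz k) hL0
      rw [abs_of_pos p0] at n0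
      rw [div_le_div_iff₀ (by nlinarith) hL0]
      nlinarith [hz k]
    linarith
  have hsum : ∑ k, ((z k).im + h) / ‖z k - pt x₀ (-h)‖ ^ 2 - Fintype.card ι / L ≤
      (L - h) * ‖∑ k, φ (z k)‖ := by
    calc _ = ∑ k, (((z k).im + h) / ‖z k - pt x₀ (-h)‖ ^ 2 - 1 / L) := by
          rw [Finset.sum_sub_distrib]; simp [div_eq_mul_inv]
      _ ≤ ∑ k, (-((L - h : ℝ) : ℂ) * φ (z k)).re := Finset.sum_le_sum fun k _ => hre k
      _ = (-((L - h : ℝ) : ℂ) * ∑ k, φ (z k)).re := by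
          rw [Finset.mul_sum, Complex.re_sum]
      _ ≤ ‖-((L - h : ℝ) : ℂ) * ∑ k, φ (z k)‖ := Complex.re_le_norm _
      _ = _ := by
          rw [norm_mul, norm_neg, Complex.norm_real, Real.norm_of_nonneg (by linarith)]
  have hlog : 0 ≤ Real.log (144 * L / (25 * h)) := by
    apply Real.log_nonneg
    rw [le_div_iff₀ (by positivity)]
    linarith
  have hD : 0 < 144 * L - 25 * h := by linarith
  have hpi := Real.pi_pos
  have hq : (L - h) * (169 / (144 * L - 25 * h)) ≤ 169 / 144 := by
    rw [mul_div_assoc', div_le_div_iff₀ hD (by norm_num)]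
    linarith
  have hn : (L - h) * ‖∑ k, φ (z k)‖ ≤
      169 / (144 * Real.pi) * Real.log (144 * L / (25 * h)) := by
    have s1 : ‖∑ k, φ (z k)‖ ≤
        Real.log (144 * L / (25 * h)) * (169 / (144 * L - 25 * h)) / Real.pi := by
      rw [le_div_iff₀ hpi]
      have := key.trans hint
      linarith
    calc (L - h) * ‖∑ k, φ (z k)‖
        ≤ (L - h) * (Real.log (144 * L / (25 * h)) * (169 / (144 * L - 25 * h)) / Real.pi) := by
          have : 0 ≤ L - h := by linarith
          gcongr
      _ = (L - h) * (169 / (144 * L - 25 * h)) *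
            (Real.log (144 * L / (25 * h)) / Real.pi) := by ring
      _ ≤ 169 / 144 * (Real.log (144 * L / (25 * h)) / Real.pi) := by gcongr
      _ = _ := by field_simp
  linarith

end Carleson

/-! ### Blaschke factors -/

/-- The Blaschke factor of the upper half-plane with zero at `a`. -/
def blaschke (a w : ℂ) : ℂ := (w - a) / (w - (starRingEnd ℂ) a)

lemma norm_sub_conj_sq (a w : ℂ) :
    ‖w - (starRingEnd ℂ) a‖ ^ 2 = ‖w - a‖ ^ 2 + 4 * w.im * a.im := by
  rw [Complex.sq_norm, Complex.sq_norm, Complex.normSq_apply, Complex.normSq_apply]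
  simp
  ring

lemma norm_blaschke_le_one {a w : ℂ} (ha : 0 < a.im) (hw : 0 ≤ w.im) : ‖blaschke a w‖ ≤ 1 := by
  rw [blaschke, norm_div]
  apply div_le_one_of_le₀ _ (norm_nonneg _)
  apply le_of_sq_le_sq _ (norm_nonneg _)
  rw [norm_sub_conj_sq]
  nlinarith [mul_nonneg hw ha.le]

lemma norm_blaschke_ofReal {a : ℂ} (ha : 0 < a.im) (x : ℝ) : ‖blaschke a x‖ = 1 := by
  have h : ‖(x : ℂ) - (starRingEnd ℂ) a‖ = ‖(x : ℂ) - a‖ := by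
    rw [← Complex.norm_conj]; simp
  rw [blaschke, norm_div, h, div_self]
  exact norm_ne_zero_iff.2 (ne_ofReal_of_im_pos ha x)

lemma blaschke_ne_zero {a w : ℂ} (ha : 0 < a.im) (hw : 0 < w.im) (h : w ≠ a) :
    blaschke a w ≠ 0 :=
  div_ne_zero (sub_ne_zero.2 h) (sub_conj_ne_zero ha hw.le)

/-- This form is monotone in the heights and in `‖w - a‖`, so it serves both near and far poles. -/
lemma neg_log_norm_blaschke {a w : ℂ} (ha : 0 < a.im) (hw : 0 < w.im) (h : w ≠ a) :
    -Real.log ‖blaschke a w‖ = 1 / 2 * Real.log (1 + 4 * w.im * a.im / ‖w - a‖ ^ 2) := by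
  have p1 : 0 < ‖w - a‖ := norm_pos_iff.2 (sub_ne_zero.2 h)
  have p2 : 0 < ‖w - (starRingEnd ℂ) a‖ := norm_pos_iff.2 (sub_conj_ne_zero ha hw.le)
  have e : 1 + 4 * w.im * a.im / ‖w - a‖ ^ 2 = (‖w - (starRingEnd ℂ) a‖ / ‖w - a‖) ^ 2 := by
    rw [div_pow, norm_sub_conj_sq]
    field_simp
  rw [e, Real.log_pow, blaschke, norm_div, Real.log_div p1.ne' p2.ne', Real.log_div p2.ne' p1.ne']
  push_cast
  ring

/-! ### Cancelling the poles by a Blaschke product, and counting residues -/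

section BlaschkeProduct

variable {ι : Type*} [Fintype ι] {z : ι → ℂ} {f : ℂ → ℂ} {g : ℝ → ℂ}

lemma differentiableOn_blaschke {a : ℂ} (ha : 0 < a.im) :
    DifferentiableOn ℂ (blaschke a) {w : ℂ | 0 < w.im} := by
  unfold blaschke
  refine DifferentiableOn.div (by fun_prop) (by fun_prop) ?_
  intro w hw
  exact sub_conj_ne_zero ha (le_of_lt hw)

lemma tendsto_blaschke {a : ℂ} (ha : 0 < a.im) (x : ℝ) :
    Tendsto (fun t => blaschke a (pt x t)) (𝓝[>] 0) (𝓝 (blaschke a x)) :=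
  (tendsto_ofReal_sub_pt x a).div (tendsto_ofReal_sub_pt x _) (sub_conj_ne_zero ha (by simp))

open Classical in
/-- The product of `∑ 1 / (w - zₖ) + f w` and the Blaschke product with zeros `zₖ`, with the
removable singularities removed. -/
def regularized (z : ι → ℂ) (f : ℂ → ℂ) (w : ℂ) : ℂ :=
  (∏ k, blaschke (z k) w) * f w +
    ∑ k, 1 / (w - (starRingEnd ℂ) (z k)) * ∏ j ∈ Finset.univ.erase k, blaschke (z j) w

/-- The constant `c` stands for `f w` at interior points and for `g x` on the boundary. -/
lemma regularized_sum_eq (z : ι → ℂ) {w : ℂ} (hw : ∀ k, w ≠ z k) (c : ℂ) :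
    regularized z (fun _ => c) w = (∏ k, blaschke (z k) w) * (∑ k, 1 / (w - z k) + c) := by
  classical
  rw [regularized, mul_add, add_comm, Finset.mul_sum]
  congr 1
  refine Finset.sum_congr rfl fun k _ => ?_
  rw [← Finset.mul_prod_erase _ _ (Finset.mem_univ k)]
  have h := sub_ne_zero.2 (hw k)
  simp only [blaschke]
  field_simp

/-- The maximum principle for a simple fraction corrected by a bounded analytic function. -/
lemma norm_blaschke_mul_le_one (hz : ∀ k, 0 < (z k).im) (hf : IsHInfty f)
    (hg : HasVerticalLimit f g) (h1 : ∀ᵐ x : ℝ, ‖∑ k, 1 / ((x : ℂ) - z k) + g x‖ ≤ 1)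
    {w : ℂ} (hw : 0 < w.im) (hwz : ∀ k, w ≠ z k) :
    (∏ k, ‖blaschke (z k) w‖) * ‖∑ k, 1 / (w - z k) + f w‖ ≤ 1 := by
  classical
  obtain ⟨hfd, M, hM⟩ := hf
  have hprod : ∀ (s : Finset ι) (w : ℂ), 0 < w.im → ‖∏ k ∈ s, blaschke (z k) w‖ ≤ 1 := by
    intro s w hw
    rw [norm_prod]
    exact Finset.prod_le_one (fun _ _ => norm_nonneg _)
      fun k _ => norm_blaschke_le_one (hz k) hw.le
  have hd : DifferentiableOn ℂ (regularized z f) {w : ℂ | 0 < w.im} := by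
    unfold regularized
    refine DifferentiableOn.add (DifferentiableOn.mul ?_ hfd) ?_
    · exact DifferentiableOn.fun_finsetProd fun k _ => differentiableOn_blaschke (hz k)
    · refine DifferentiableOn.fun_sum fun k _ => DifferentiableOn.mul ?_ ?_
      · refine DifferentiableOn.div (by fun_prop) (by fun_prop) ?_
        intro w hw
        exact sub_conj_ne_zero (hz k) (le_of_lt hw)
      · exact DifferentiableOn.fun_finsetProd fun k _ => differentiableOn_blaschke (hz k)
  have hb : ∀ w : ℂ, 0 < w.im → ‖regularized z f w‖ ≤ M + ∑ k, 1 / (z k).im := by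
    intro w hw
    unfold regularized
    refine (norm_add_le _ _).trans (add_le_add ?_ ((norm_sum_le _ _).trans
      (Finset.sum_le_sum fun k _ => ?_)))
    · rw [norm_mul]
      exact (mul_le_of_le_one_left (norm_nonneg _) (hprod _ w hw)).trans (hM w hw)
    · rw [norm_mul, norm_div, norm_one]
      refine (mul_le_of_le_one_right (by positivity) (hprod _ w hw)).trans ?_
      exact one_div_le_one_div_of_le (hz k) (im_le_norm_sub_conj hw.le)
  have hl : HasVerticalLimit (regularized z f) (fun x => regularized z (fun _ => g x) x) := by
    filter_upwards [hg] with x hx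
    unfold regularized
    refine Tendsto.add (Tendsto.mul (tendsto_finsetProd _ fun k _ => tendsto_blaschke (hz k) x) hx)
      (tendsto_finsetSum _ fun k _ => Tendsto.mul (Tendsto.div tendsto_const_nhds
        (tendsto_ofReal_sub_pt x _) (sub_conj_ne_zero (hz k) (by simp)))
        (tendsto_finsetProd _ fun k _ => tendsto_blaschke (hz k) x))
  have hbd : ∀ᵐ x : ℝ, ‖regularized z (fun _ => g x) x‖ ≤ 1 := by
    filter_upwards [h1] with x hx
    rw [regularized_sum_eq z (fun k => sub_ne_zero.1 (ne_ofReal_of_im_pos (hz k) x)), norm_mul,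
      norm_prod]
    simpa [norm_blaschke_ofReal (hz _)] using hx
  have := norm_le_one_of_boundary hd hb hl hbd hw
  have e : regularized z f w = regularized z (fun _ => f w) w := rfl
  rwa [e, regularized_sum_eq z hwz, norm_mul, norm_prod] at this

/-- The residue theorem on a small circle around one of the poles. -/
lemma one_le_radius_mul (hf : IsHInfty f) (k₀ : ι) {s C : ℝ} (hs : 0 < s) (hs' : s < (z k₀).im)
    (hne : ∀ k, ‖z k - z k₀‖ ≠ s)
    (hC : ∀ w : ℂ, ‖w - z k₀‖ = s → ‖∑ k, 1 / (w - z k) + f w‖ ≤ C) : 1 ≤ s * C := by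
  classical
  have hsub : Metric.closedBall (z k₀) s ⊆ {w : ℂ | 0 < w.im} := by
    intro w hw
    rw [mem_closedBall_iff_norm] at hw
    have := (Complex.abs_im_le_norm (w - z k₀)).trans hw
    simp only [Complex.sub_im, abs_le] at this
    change 0 < w.im
    linarith
  have hfc : ContinuousOn f (Metric.closedBall (z k₀) s) := hf.1.continuousOn.mono hsub
  have hf0 : ∮ w in C(z k₀, s), f w = 0 :=
    Complex.circleIntegral_eq_zero_of_differentiable_on_off_countable hs.le Set.countable_empty hfc
      fun w hw => (hf.1 w (hsub (Metric.ball_subset_closedBall hw.1))).differentiableAt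
        (isOpen_upper.mem_nhds (hsub (Metric.ball_subset_closedBall hw.1)))
  have hci : ∀ k, CircleIntegrable (fun w => 1 / (w - z k)) (z k₀) s := by
    intro k
    refine ContinuousOn.circleIntegrable hs.le (ContinuousOn.div (by fun_prop) (by fun_prop) ?_)
    intro w hw h
    rw [mem_sphere_iff_norm, sub_eq_zero.1 h] at hw
    exact hne k hw
  have hk : ∀ k, (∮ w in C(z k₀, s), 1 / (w - z k)) =
      if ‖z k - z k₀‖ < s then 2 * Real.pi * Complex.I else 0 := by
    intro k
    split_ifs with h
    · simp_rw [one_div]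
      exact circleIntegral.integral_sub_inv_of_mem_ball (mem_ball_iff_norm.2 h)
    · have hn : ∀ w ∈ Metric.closedBall (z k₀) s, w - z k ≠ 0 := by
        intro w hw h'
        rw [mem_closedBall_iff_norm, sub_eq_zero.1 h'] at hw
        exact h (lt_of_le_of_ne hw (hne k))
      refine Complex.circleIntegral_eq_zero_of_differentiable_on_off_countable hs.le
        Set.countable_empty (ContinuousOn.div (by fun_prop) (by fun_prop) hn) fun w hw => ?_
      exact DifferentiableAt.div (by fun_prop) (by fun_prop)
        (hn w (Metric.ball_subset_closedBall hw.1))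
  have hI : (∮ w in C(z k₀, s), (∑ k, 1 / (w - z k) + f w)) =
      ((Finset.univ.filter fun k => ‖z k - z k₀‖ < s).card : ℂ) * (2 * Real.pi * Complex.I) := by
    rw [circleIntegral.integral_add (CircleIntegrable.fun_sum _ fun k _ => hci k)
      (hfc.mono Metric.sphere_subset_closedBall |>.circleIntegrable hs.le), hf0, add_zero,
      circleIntegral.integral_fun_sum fun k _ => hci k]
    simp_rw [hk]
    rw [← Finset.sum_filter, Finset.sum_const, nsmul_eq_mul]
  -- All residues are `1`, so other poles inside the circle only add to the count.
  have hcard : (1 : ℝ) ≤ (Finset.univ.filter fun k => ‖z k - z k₀‖ < s).card := by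
    have : 0 < (Finset.univ.filter fun k => ‖z k - z k₀‖ < s).card :=
      Finset.card_pos.2 ⟨k₀, by simpa using hs⟩
    exact_mod_cast this
  have hle := circleIntegral.norm_integral_le_of_norm_le_const hs.le
    (f := fun w => ∑ k, 1 / (w - z k) + f w) (c := z k₀) (C := C)
    (fun w hw => hC w (mem_sphere_iff_norm.1 hw))
  have h4 : ‖(2 * Real.pi * Complex.I : ℂ)‖ = 2 * Real.pi := by
    simp [abs_of_pos Real.pi_pos]
  rw [hI, norm_mul, h4, Complex.norm_natCast] at hle
  have := Real.pi_pos
  nlinarith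

end BlaschkeProduct

/-! ### Choosing a radius that stays away from the poles -/

/-- The convex function `x log x` lies above its tangent at `c`. -/
lemma mul_log_ge {x c : ℝ} (hx : 0 ≤ x) (hc : 0 < c) :
    x * Real.log c + x - c ≤ x * Real.log x := by
  rcases hx.eq_or_lt with rfl | hx
  · simp [hc.le]
  · have := Real.one_sub_inv_le_log_of_pos (show 0 < x / c by positivity)
    rw [Real.log_div hx.ne' hc.ne', inv_div] at this
    have h2 := mul_le_mul_of_nonneg_left this hx.le
    have e : x * (1 - c / x) = x - c := by field_simp
    rw [e] at h2
    linarith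

/-- Since `Real.log` sees only the absolute value, this is the integral of `log |s - d|`. The
extreme case is `d = 1/4`, the midpoint, hence the tangents at `1/4`. -/
lemma integral_log_sub_ge {d : ℝ} (hd : 0 ≤ d) :
    -(1 / 2 * (1 + Real.log 4)) ≤ ∫ s in (0 : ℝ)..(1 / 2), Real.log (s - d) := by
  rw [intervalIntegral.integral_comp_sub_right, integral_log, zero_sub, Real.log_neg_eq_log]
  have h4 : Real.log (1 / 4) = -Real.log 4 := by rw [one_div, Real.log_inv]
  rcases le_total d (1 / 2) with h | h
  · have a1 := mul_log_ge hd (show (0 : ℝ) < 1 / 4 by norm_num)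
    have a2 := mul_log_ge (show 0 ≤ 1 / 2 - d by linarith) (show (0 : ℝ) < 1 / 4 by norm_num)
    rw [h4] at a1 a2
    linarith
  · have e : Real.log (1 / 2 - d) = Real.log (d - 1 / 2) := by
      rw [← Real.log_neg_eq_log]; ring_nf
    rw [e]
    have a1 : (d - 1 / 2) * Real.log (d - 1 / 2) ≤ (d - 1 / 2) * Real.log d := by
      rcases h.eq_or_lt with h' | h'
      · simp [← h']
      · exact mul_le_mul_of_nonneg_left (Real.log_le_log (by linarith) (by linarith)) (by linarith)
    have a2 : Real.log (1 / 4) ≤ Real.log d := Real.log_le_log (by norm_num) (by linarith)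
    rw [h4] at a2
    linarith

/-- Average over `σ` in `(0, 1/2)`: some `σ` outside a null set does no worse than the mean, which
costs `1 + log 4` per pole. The null set contains the forbidden values `d k`. -/
lemma exists_good_radius {ι : Type*} [Finite ι] (S : Finset ι) {d : ι → ℝ} (hd : ∀ k, 0 ≤ d k) :
    ∃ σ : ℝ, 0 < σ ∧ σ < 1 / 2 ∧ (∀ k, d k ≠ σ) ∧
      -∑ k ∈ S, Real.log (σ - d k) ≤ S.card * (1 + Real.log 4) := by
  set μ : Measure ℝ := volume.restrict (Set.Ioc 0 (1 / 2)) with hμ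
  have hii : ∀ k, IntervalIntegrable (fun s => Real.log (s - d k)) volume 0 (1 / 2) := by
    intro k
    have := (intervalIntegral.intervalIntegrable_log'
      (a := 0 - d k) (b := 1 / 2 - d k)).comp_sub_right (d k)
    simpa using this
  have hi : ∀ k, Integrable (fun s => Real.log (s - d k)) μ := fun k => by
    have := hii k
    rwa [intervalIntegrable_iff_integrableOn_Ioc_of_le (by norm_num)] at this
  have hμ0 : μ ≠ 0 := by
    rw [hμ, Ne, Measure.restrict_eq_zero]
    simp
  have hN : μ ((Set.Ioo 0 (1 / 2))ᶜ ∪ Set.range d) = 0 := by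
    refine measure_union_null ?_ ((Set.finite_range d).measure_zero _)
    rw [hμ, Measure.restrict_apply measurableSet_Ioo.compl]
    refine measure_mono_null (t := {(1 / 2 : ℝ)}) ?_ (by simp)
    intro x hx
    simp only [Set.mem_inter_iff, Set.mem_compl_iff, Set.mem_Ioo, Set.mem_Ioc, not_and,
      not_lt] at hx
    exact le_antisymm hx.2.2 (hx.1 hx.2.1)
  obtain ⟨σ, hσ, hle⟩ := exists_notMem_null_le_average hμ0
    ((integrable_finsetSum S fun k _ => hi k).neg) hN
  simp only [Set.mem_union, Set.mem_compl_iff, not_or, not_not, Set.mem_Ioo, Set.mem_range,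
    not_exists] at hσ
  refine ⟨σ, hσ.1.1, hσ.1.2, hσ.2, ?_⟩
  simp only [Pi.neg_apply] at hle
  refine hle.trans ?_
  rw [average_eq, integral_neg, integral_finsetSum S fun k _ => hi k]
  have hm : μ.real Set.univ = 1 / 2 := by
    rw [hμ, measureReal_restrict_apply_univ, Real.volume_real_Ioc]
    norm_num
  rw [hm, smul_eq_mul]
  have : ∑ k ∈ S, -(1 / 2 * (1 + Real.log 4)) ≤ ∑ k ∈ S, ∫ s, Real.log (s - d k) ∂μ := by
    refine Finset.sum_le_sum fun k _ => ?_
    have := integral_log_sub_ge (hd k)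
    rwa [intervalIntegral.integral_of_le (by norm_num)] at this
  rw [Finset.sum_const, nsmul_eq_mul] at this
  norm_num
  linarith

/-! ### The lower bound for the lowest pole -/

section LowestPole

lemma neg_log_blaschke_le_of_near {h y D σ W r : ℝ} (hh : 0 < h) (hy : h ≤ y) (hyD : y ≤ h + D)
    (hD0 : 0 ≤ D) (hD : D ≤ 2 * h) (hσ0 : 0 < σ) (hσ : σ < 1 / 2) (hW0 : 0 < W)
    (hW : W ≤ h + σ * h) (hr : |σ * h - D| ≤ r) (hne : D / h ≠ σ) :
    1 / 2 * Real.log (1 + 4 * W * y / r ^ 2) ≤ 7 / 4 - Real.log (σ - D / h) := by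
  have p : 0 < |σ - D / h| := abs_pos.2 (sub_ne_zero.2 hne.symm)
  have e : |σ * h - D| = h * |σ - D / h| := by
    rw [← abs_of_pos hh, ← abs_mul, abs_of_pos hh]
    congr 1
    field_simp
  rw [e] at hr
  have q : (σ - D / h) ^ 2 ≤ 4 := by
    have h1 : D / h ≤ 2 := by rw [div_le_iff₀ hh]; exact hD
    have h2 : 0 ≤ D / h := by positivity
    nlinarith
  have hy3 : y ≤ 3 * h := by linarith
  have hW2 : W ≤ 3 / 2 * h := by nlinarith
  have hWy : 4 * W * y ≤ 18 * h ^ 2 := by nlinarith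
  have hy0 : 0 < y := hh.trans_le hy
  -- Here `18 = 4 · (3/2) · 3`, and `18 + 4` is rounded up to `32` so that half the logarithm,
  -- `(5/2) log 2`, stays below `7/4`.
  have hle : 1 + 4 * W * y / r ^ 2 ≤ 32 / |σ - D / h| ^ 2 := by
    have r0 : 0 < r := lt_of_lt_of_le (by positivity) hr
    calc 1 + 4 * W * y / r ^ 2 ≤ 1 + 18 * h ^ 2 / (h * |σ - D / h|) ^ 2 := by gcongr
      _ = (|σ - D / h| ^ 2 + 18) / |σ - D / h| ^ 2 := by
        generalize |σ - D / h| = v at p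
        field_simp
      _ ≤ 32 / |σ - D / h| ^ 2 := by
        gcongr
        rw [sq_abs]
        linarith
  have hpos : 0 < 1 + 4 * W * y / r ^ 2 := by positivity
  have hl := Real.log_le_log hpos hle
  rw [Real.log_div (by norm_num) (by positivity), Real.log_pow, Real.log_abs] at hl
  have h32 : Real.log 32 = 5 * Real.log 2 := by
    rw [show (32 : ℝ) = 2 ^ 5 by norm_num, Real.log_pow]; norm_num
  have := Real.log_two_lt_d9
  push_cast at hl
  linarith

/-- Use `log (1 + u) ≤ u`. The circle has radius below `h / 2 < D / 4`, so its points are at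
distance at least `3D/4` from the pole. The constant `22` works because `16/3 ≤ 22/4`. -/
lemma neg_log_blaschke_le_of_far {h y D σ W r : ℝ} (hh : 0 < h) (hy : h ≤ y) (hyD : y ≤ h + D)
    (hD : 2 * h < D) (hσ : σ < 1 / 2) (hW0 : 0 < W) (hW : W ≤ h + σ * h)
    (hr : |σ * h - D| ≤ r) :
    1 / 2 * Real.log (1 + 4 * W * y / r ^ 2) ≤ 22 * h * ((y + h) / (D ^ 2 + 4 * h * y)) := by
  have hD0 : 0 < D := by linarith
  have hy0 : 0 < y := hh.trans_le hy
  have hr' : 3 / 4 * D ≤ r := by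
    refine le_trans ?_ hr
    rw [abs_sub_comm]
    refine le_trans ?_ (le_abs_self _)
    nlinarith
  have hW2 : W ≤ 3 / 2 * h := by nlinarith
  have h1 : 1 / 2 * Real.log (1 + 4 * W * y / r ^ 2) ≤ 1 / 2 * (4 * W * y / r ^ 2) := by
    gcongr
    have := Real.log_le_sub_one_of_pos (show 0 < 1 + 4 * W * y / r ^ 2 by positivity)
    linarith
  refine h1.trans ?_
  have h2 : 4 * W * y / r ^ 2 ≤ 4 * (3 / 2 * h) * y / (3 / 4 * D) ^ 2 := by gcongr
  have h3 : D ^ 2 + 4 * h * y ≤ 4 * D ^ 2 := by nlinarith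
  have h4 : 22 * h * ((y + h) / (4 * D ^ 2)) ≤ 22 * h * ((y + h) / (D ^ 2 + 4 * h * y)) := by
    gcongr
  refine le_trans ?_ h4
  refine (mul_le_mul_of_nonneg_left h2 (by norm_num)).trans ?_
  have e1 : 1 / 2 * (4 * (3 / 2 * h) * y / (3 / 4 * D) ^ 2) = (16 / 3 * h * y) / D ^ 2 := by
    field_simp; norm_num
  have e2 : 22 * h * ((y + h) / (4 * D ^ 2)) = (11 / 2 * h * (y + h)) / D ^ 2 := by
    field_simp; norm_num
  rw [e1, e2]
  apply div_le_div_of_nonneg_right _ (sq_nonneg D)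
  nlinarith [mul_pos hh hy0]

variable {ι : Type*} [Fintype ι] {z : ι → ℂ} {f : ℂ → ℂ} {g : ℝ → ℂ}

/-- On the circle of radius `σ h` about the lowest pole, `|ρ + f|` is at most the inverse of the
Blaschke product. Far poles are estimated one by one, near ones only in sum through the choice of
`σ`. The residue inequality and a logarithm then conclude. -/
lemma neg_log_im_le (hz : ∀ k, 0 < (z k).im) (hf : IsHInfty f)
    (hg : HasVerticalLimit f g) (h1 : ∀ᵐ x : ℝ, ‖∑ k, 1 / ((x : ℂ) - z k) + g x‖ ≤ 1)
    (k₀ : ι) (hmin : ∀ k, (z k₀).im ≤ (z k).im) :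
    -Real.log (z k₀).im ≤ 22 * (z k₀).im *
      ∑ k, ((z k).im + (z k₀).im) / ‖z k - (starRingEnd ℂ) (z k₀)‖ ^ 2 := by
  classical
  set h := (z k₀).im with hh'
  have hh : 0 < h := hz k₀
  set D : ι → ℝ := fun k => ‖z k - z k₀‖ with hD
  have hD0 : ∀ k, 0 ≤ D k := fun k => norm_nonneg _
  have hyD : ∀ k, (z k).im ≤ h + D k := by
    intro k
    have := (le_abs_self _).trans (Complex.abs_im_le_norm (z k - z k₀))
    simp only [Complex.sub_im] at this
    change (z k).im - h ≤ D k at this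
    linarith
  have hT : ∀ k, ‖z k - (starRingEnd ℂ) (z k₀)‖ ^ 2 = D k ^ 2 + 4 * h * (z k).im := by
    intro k
    rw [norm_sub_conj_sq]
    ring
  simp_rw [hT]
  set S : Finset ι := Finset.univ.filter fun k => D k ≤ 2 * h with hS
  obtain ⟨σ, hσ0, hσ, hne, hsum⟩ := exists_good_radius S (d := fun k => D k / h)
    fun k => div_nonneg (hD0 k) hh.le
  set T : ι → ℝ := fun k => ((z k).im + h) / (D k ^ 2 + 4 * h * (z k).im) with hTdef
  have hs : 0 < σ * h := by positivity
  have hDne : ∀ k, D k ≠ σ * h := by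
    intro k hk
    exact hne k (by rw [hk]; field_simp)
  have hC : ∀ w : ℂ, ‖w - z k₀‖ = σ * h →
      ‖∑ k, 1 / (w - z k) + f w‖ ≤ Real.exp (22 * h * ∑ k, T k) := by
    intro w hw
    have him := (Complex.abs_im_le_norm (w - z k₀)).trans_eq hw
    simp only [Complex.sub_im, abs_le] at him
    change -(σ * h) ≤ w.im - h ∧ w.im - h ≤ σ * h at him
    have hw0 : 0 < w.im := by nlinarith
    have hW : w.im ≤ h + σ * h := by linarith
    have hwz : ∀ k, w ≠ z k := by
      rintro k rfl
      exact hDne k hw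
    have hr : ∀ k, |σ * h - D k| ≤ ‖w - z k‖ := by
      intro k
      rw [← hw]
      have := abs_norm_sub_norm_le (w - z k₀) (z k - z k₀)
      simpa using this
    have hb : ∀ k, 0 < ‖blaschke (z k) w‖ := fun k =>
      norm_pos_iff.2 (blaschke_ne_zero (hz k) hw0 (hwz k))
    have hlog : -Real.log (∏ k, ‖blaschke (z k) w‖) ≤ 22 * h * ∑ k, T k := by
      rw [Real.log_prod fun k _ => (hb k).ne', ← Finset.sum_neg_distrib, Finset.mul_sum,
        ← Finset.sum_filter_add_sum_filter_not Finset.univ (fun k => D k ≤ 2 * h),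
        ← Finset.sum_filter_add_sum_filter_not Finset.univ (fun k => D k ≤ 2 * h)
          (fun k => 22 * h * T k)]
      refine add_le_add ?_ (Finset.sum_le_sum fun k hk => ?_)
      · have near : ∀ k ∈ S, -Real.log ‖blaschke (z k) w‖ ≤
            7 / 4 - Real.log (σ - D k / h) := by
          intro k hk
          rw [neg_log_norm_blaschke (hz k) hw0 (hwz k)]
          exact neg_log_blaschke_le_of_near hh (hmin k) (hyD k) (hD0 k)
            (Finset.mem_filter.1 hk).2 hσ0 hσ hw0 hW (hr k) (hne k)
        refine (Finset.sum_le_sum near).trans ?_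
        rw [Finset.sum_sub_distrib, Finset.sum_const, nsmul_eq_mul]
        -- A near pole costs `7/4 + 1 + log 4` on average, less than the `22/4` that its own term of
        -- the sum pays.
        have hTk : ∀ k ∈ S, 11 / 2 ≤ 22 * h * T k := by
          intro k hk
          have hk' := (Finset.mem_filter.1 hk).2
          have hy0 := hz k
          have : 1 / 4 ≤ h * T k := by
            simp only [hTdef]
            rw [← mul_div_assoc, div_le_div_iff₀ (by norm_num) (by positivity)]
            nlinarith [hD0 k]
          linarith
        have hTs := Finset.sum_le_sum hTk
        rw [Finset.sum_const, nsmul_eq_mul] at hTs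
        refine le_trans ?_ hTs
        have h4 : Real.log 4 ≤ 2 := by
          rw [show (4 : ℝ) = 2 ^ 2 by norm_num, Real.log_pow]
          have := Real.log_two_lt_d9
          push_cast
          linarith
        have hc : (0 : ℝ) ≤ S.card := by positivity
        nlinarith
      · rw [neg_log_norm_blaschke (hz k) hw0 (hwz k)]
        exact neg_log_blaschke_le_of_far hh (hmin k) (hyD k)
          (not_le.1 (Finset.mem_filter.1 hk).2) hσ hw0 hW (hr k)
    have hmul := norm_blaschke_mul_le_one hz hf hg h1 hw0 hwz
    have hP : 0 < ∏ k, ‖blaschke (z k) w‖ := Finset.prod_pos fun k _ => hb k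
    calc ‖∑ k, 1 / (w - z k) + f w‖ ≤ (∏ k, ‖blaschke (z k) w‖)⁻¹ := by
          rwa [← one_div, le_div_iff₀ hP, mul_comm]
      _ = Real.exp (-Real.log (∏ k, ‖blaschke (z k) w‖)) := by
          rw [Real.exp_neg, Real.exp_log hP]
      _ ≤ _ := Real.exp_le_exp.2 hlog
  have hone := one_le_radius_mul hf k₀ hs (by nlinarith : σ * h < h) hDne hC
  have h2 : 1 ≤ h * Real.exp (22 * h * ∑ k, T k) := by
    refine hone.trans ?_
    gcongr
    nlinarith
  have h3 := Real.log_nonneg h2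
  rw [Real.log_mul hh.ne' (Real.exp_pos _).ne', Real.log_exp] at h3
  linarith

/-- The basic inequality for the height of the lowest pole. -/
lemma neg_log_im_le_log {n : ℕ} (hn : 1 < n) (hcard : Fintype.card ι ≤ n)
    (hz : ∀ k, 0 < (z k).im) (hf : IsHInfty f)
    (hg : HasVerticalLimit f g) (h1 : ∀ᵐ x : ℝ, ‖∑ k, 1 / ((x : ℂ) - z k) + g x‖ ≤ 1)
    (k₀ : ι) (hmin : ∀ k, (z k₀).im ≤ (z k).im) (hle : (z k₀).im ≤ 1) :
    -Real.log (z k₀).im ≤ 50 + 33 / 4 * (z k₀).im * Real.log n := by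
  have key := neg_log_im_le hz hf hg h1 k₀ hmin
  set h := (z k₀).im with hh'
  have hh : 0 < h := hz k₀
  have hn' : (1 : ℝ) < n := by exact_mod_cast hn
  have e : pt (z k₀).re (-h) = (starRingEnd ℂ) (z k₀) := by
    apply Complex.ext <;> simp [hh']
  -- With `L = n` the term `card / L` is at most `1`, while the logarithm is only of size `log (n /
  -- h)`.
  have hT := sum_kernel_le hz hf hg h1 hh (hle.trans_lt hn') (z k₀).re
  rw [e] at hT
  have hcard' : (Fintype.card ι : ℝ) / n ≤ 1 := by
    apply div_le_one_of_le₀ _ (by positivity)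
    exact_mod_cast hcard
  have hpi := Real.pi_gt_d2
  have hc : 169 / (144 * Real.pi) ≤ 3 / 8 := by
    rw [div_le_div_iff₀ (by positivity) (by norm_num)]
    linarith
  have hlogn : 0 ≤ Real.log n := Real.log_nonneg hn'.le
  have hlogh : Real.log h ≤ 0 := Real.log_nonpos hh.le hle
  have hlog : Real.log (144 * n / (25 * h)) ≤ 3 + Real.log n - Real.log h := by
    have e2 : 144 * (n : ℝ) / (25 * h) = 144 / 25 * n / h := by field_simp
    rw [e2, Real.log_div (by positivity) hh.ne', Real.log_mul (by norm_num) (by positivity)]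
    have : Real.log (144 / 25) ≤ 3 := by
      have h8 : Real.log (144 / 25) ≤ Real.log (2 ^ 3) :=
        Real.log_le_log (by norm_num) (by norm_num)
      rw [Real.log_pow] at h8
      have := Real.log_two_lt_d9
      push_cast at h8
      linarith
    linarith
  have hlog0 : 0 ≤ 3 + Real.log n - Real.log h := by linarith
  have hT2 : ∑ k, ((z k).im + h) / ‖z k - (starRingEnd ℂ) (z k₀)‖ ^ 2 ≤
      1 + 3 / 8 * (3 + Real.log n - Real.log h) := by
    refine hT.trans (add_le_add hcard' ?_)
    exact (mul_le_mul_of_nonneg_left hlog (by positivity)).trans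
      (mul_le_mul_of_nonneg_right hc hlog0)
  -- The `-log h` hidden in `log (n / h)` is harmless after multiplication by `h`.
  have hx : -(h * Real.log h) ≤ 1 - h := by
    have := mul_log_ge hh.le one_pos
    simp at this
    linarith
  have h3 := mul_le_mul_of_nonneg_left hT2 (show 0 ≤ 22 * h by positivity)
  nlinarith

end LowestPole

/-! ### Lower bounds for admissible simple fractions -/

lemma IsBoundaryFunction.hasVerticalLimit {f : ℂ → ℂ} {g : ℝ → ℂ} (h : IsBoundaryFunction f g) :
    HasVerticalLimit f g := by
  filter_upwards [h] with x hx
  refine (hx 1 one_pos).comp (tendsto_nhdsWithin_iff.2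
    ⟨(tendsto_pt x).mono_left nhdsWithin_le_nhds, ?_⟩)
  filter_upwards [self_mem_nhdsWithin] with t ht
  change |(pt x t).re - x| < 1 * (pt x t).im
  simpa using ht

lemma ae_norm_le_of_eLpNorm_top_le {F : ℝ → ℂ} (h : eLpNorm F ⊤ volume ≤ 1) :
    ∀ᵐ x : ℝ, ‖F x‖ ≤ 1 := by
  rw [eLpNorm_exponent_top] at h
  filter_upwards [ae_le_eLpNormEssSup (f := F) (μ := volume)] with x hx
  have := hx.trans h
  rwa [← ofReal_norm, ENNReal.ofReal_le_one] at this

lemma exists_minAbsIm_eq {n : ℕ} (hn : 0 < n) (z : Fin n → ℂ) :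
    ∃ k₀, minAbsIm z = |(z k₀).im| ∧ ∀ k, |(z k₀).im| ≤ |(z k).im| := by
  have : Nonempty (Fin n) := ⟨⟨0, hn⟩⟩
  obtain ⟨k₀, hk₀⟩ := exists_eq_ciInf_of_finite (f := fun k => |(z k).im|)
  refine ⟨k₀, hk₀.symm, fun k => ?_⟩
  rw [hk₀]
  exact ciInf_le (Set.finite_range _).bddBelow k

/-- The restriction on the height `y` of the lowest pole of a simple fraction of order `n`. -/
def HeightBound (n : ℕ) (y : ℝ) : Prop :=
  0 < y ∧ (y ≤ 1 → -Real.log y ≤ 50 + 33 / 4 * y * Real.log n)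

lemma HeightBound.mono {m n : ℕ} {y : ℝ} (hm : 0 < m) (hmn : m ≤ n) (h : HeightBound m y) :
    HeightBound n y := by
  refine ⟨h.1, fun hy => (h.2 hy).trans ?_⟩
  have : Real.log m ≤ Real.log n :=
    Real.log_le_log (by exact_mod_cast hm) (by exact_mod_cast hmn)
  have := h.1
  gcongr

lemma heightBound_of_hardy {n : ℕ} (hn : 1 < n) {z : Fin n → ℂ} (hz : ∀ k, 0 < (z k).im)
    {f : ℂ → ℂ} {g : ℝ → ℂ} (hf : IsHInfty f) (hg : IsBoundaryFunction f g)
    (h1 : eLpNorm (fun x : ℝ => simpleFraction z (x : ℂ) + g x) ⊤ volume ≤ 1) :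
    HeightBound n (minAbsIm z) := by
  obtain ⟨k₀, hk₀, hmin⟩ := exists_minAbsIm_eq (by omega) z
  simp only [abs_of_pos (hz _)] at hk₀ hmin
  rw [hk₀]
  exact ⟨hz k₀, fun hle => neg_log_im_le_log hn (by simp) hz hf hg.hasVerticalLimit
    (ae_norm_le_of_eLpNorm_top_le h1) k₀ hmin hle⟩

lemma isHInfty_sum {κ : Type*} (s : Finset κ) {z : κ → ℂ} (hz : ∀ k ∈ s, (z k).im < 0) :
    IsHInfty fun w => ∑ k ∈ s, 1 / (w - z k) := by
  have hle : ∀ k ∈ s, ∀ w : ℂ, 0 < w.im → -(z k).im ≤ ‖w - z k‖ := by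
    intro k _ w hw
    have := (le_abs_self _).trans (Complex.abs_im_le_norm (w - z k))
    simp only [Complex.sub_im] at this
    linarith
  refine ⟨DifferentiableOn.fun_sum fun k hk => DifferentiableOn.div (by fun_prop) (by fun_prop)
    fun w hw => ?_, ∑ k ∈ s, 1 / -(z k).im, fun w hw => (norm_sum_le _ _).trans
      (Finset.sum_le_sum fun k hk => ?_)⟩
  · exact norm_pos_iff.1 (lt_of_lt_of_le (by linarith [hz k hk]) (hle k hk w hw))
  · rw [norm_div, norm_one]
    exact one_div_le_one_div_of_le (by linarith [hz k hk]) (hle k hk w hw)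

lemma tendsto_sum_of_lower {κ : Type*} (s : Finset κ) {z : κ → ℂ} (hz : ∀ k ∈ s, (z k).im < 0)
    (x : ℝ) : ContinuousAt (fun w => ∑ k ∈ s, 1 / (w - z k)) (x : ℂ) := by
  refine tendsto_finsetSum _ fun k hk => ?_
  refine ContinuousAt.div (by fun_prop) (by fun_prop) ?_
  intro h
  have := congrArg Complex.im h
  simp at this
  exact (hz k hk).ne this

lemma isBoundaryFunction_sum {κ : Type*} (s : Finset κ) {z : κ → ℂ}
    (hz : ∀ k ∈ s, (z k).im < 0) :
    IsBoundaryFunction (fun w => ∑ k ∈ s, 1 / (w - z k)) fun x => ∑ k ∈ s, 1 / ((x : ℂ) - z k) :=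
  Eventually.of_forall fun x _ _ => (tendsto_sum_of_lower s hz x).mono_left nhdsWithin_le_nhds

/-- The part of the fraction with poles below the line plays the role of `f`; the upper part has at
most `n` poles. -/
lemma neg_log_im_le_of_upper_lowest {n : ℕ} (hn : 1 < n) {z : Fin n → ℂ} (hz : ∀ k, (z k).im ≠ 0)
    (h1 : ∀ᵐ x : ℝ, ‖simpleFraction z (x : ℂ)‖ ≤ 1) (k₀ : Fin n) (hk₀ : 0 < (z k₀).im)
    (hmin : ∀ k, (z k₀).im ≤ |(z k).im|) (hle : (z k₀).im ≤ 1) :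
    -Real.log (z k₀).im ≤ 50 + 33 / 4 * (z k₀).im * Real.log n := by
  classical
  set s : Finset (Fin n) := Finset.univ.filter fun k => ¬ 0 < (z k).im with hs
  have hsl : ∀ k ∈ s, (z k).im < 0 := fun k hk =>
    lt_of_le_of_ne (not_lt.1 (Finset.mem_filter.1 hk).2) (hz k)
  have hsum : ∀ x : ℝ, simpleFraction z (x : ℂ) =
      ∑ k : {k // 0 < (z k).im}, 1 / ((x : ℂ) - z k) + ∑ k ∈ s, 1 / ((x : ℂ) - z k) := by
    intro x
    rw [simpleFraction, ← Finset.sum_filter_add_sum_filter_not Finset.univ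
      (fun k => 0 < (z k).im)]
    congr 1
    exact Finset.sum_subtype _ (by simp) _
  simp_rw [hsum] at h1
  refine neg_log_im_le_log (z := fun k : {k // 0 < (z k).im} => z k) hn ?_ (fun k => k.2)
    (isHInfty_sum s hsl) (isBoundaryFunction_sum s hsl).hasVerticalLimit h1 ⟨k₀, hk₀⟩ ?_ hle
  · simpa using Fintype.card_subtype_le (fun k : Fin n => 0 < (z k).im)
  · intro k
    have := hmin k
    rwa [abs_of_pos k.2] at this

lemma heightBound_of_norm {n : ℕ} (hn : 1 < n) {z : Fin n → ℂ} (hz : ∀ k, (z k).im ≠ 0)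
    (h1 : eLpNorm (fun x : ℝ => simpleFraction z (x : ℂ)) ⊤ volume ≤ 1) :
    HeightBound n (minAbsIm z) := by
  obtain ⟨k₀, hk₀, hmin⟩ := exists_minAbsIm_eq (by omega) z
  have hae := ae_norm_le_of_eLpNorm_top_le h1
  rw [hk₀]
  refine ⟨abs_pos.2 (hz k₀), fun hle => ?_⟩
  rcases lt_or_gt_of_ne (hz k₀) with hneg | hpos
  -- Conjugating the poles conjugates the values on the line and moves the lowest pole above it.
  · have key := neg_log_im_le_of_upper_lowest (z := fun k => (starRingEnd ℂ) (z k)) hn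
      (fun k => by simpa using hz k) (by
        filter_upwards [hae] with x hx
        have e : simpleFraction (fun k => (starRingEnd ℂ) (z k)) (x : ℂ) =
            (starRingEnd ℂ) (simpleFraction z x) := by
          simp [simpleFraction]
        rwa [e, Complex.norm_conj]) k₀ (by simpa using hneg)
        (fun k => by simpa [abs_of_neg hneg] using hmin k)
        (by simpa [abs_of_neg hneg] using hle)
    rw [abs_of_neg hneg]
    simpa using key
  · rw [abs_of_pos hpos] at hmin hle ⊢
    exact neg_log_im_le_of_upper_lowest hn hz hae k₀ hpos hmin hle

/-! ### The rate -/

lemma tendsto_log_natCast : Tendsto (fun n : ℕ => Real.log n) atTop atTop :=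
  Real.tendsto_log_atTop.comp tendsto_natCast_atTop_atTop

lemma one_lt_log {n : ℕ} (hn : 3 ≤ n) : 1 < Real.log n := by
  have h3 : (3 : ℝ) ≤ n := by exact_mod_cast hn
  rw [Real.lt_log_iff_exp_lt (by linarith)]
  exact Real.exp_one_lt_d9.trans (by linarith)

lemma rate_pos {n : ℕ} (hn : 3 ≤ n) : 0 < rate n :=
  div_pos (Real.log_pos (one_lt_log hn)) (by linarith [one_lt_log hn])

lemma rate_le_one {n : ℕ} (hn : 3 ≤ n) : rate n ≤ 1 := by
  have := one_lt_log hn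
  apply div_le_one_of_le₀ _ (by linarith)
  linarith [Real.log_le_sub_one_of_pos (show 0 < Real.log n by linarith)]

lemma eventually_rate_le : ∀ᶠ n : ℕ in atTop, ∀ y : ℝ, HeightBound n y → 1 / 9 * rate n ≤ y := by
  -- If `y < (1/9) log l / l` with `l = log n` and `t = log l`, the height bound would give `t - log
  -- t ≤ 50 + (33/4)(t/9)`. Since `(33/4)/9 = 11/12`, the leftover `t / 12` must beat `50 + log t`.
  have hlog : ∀ᶠ t : ℝ in atTop, 50 + Real.log t < t / 12 := by
    have := Real.isLittleO_log_id_atTop.bound (show (0 : ℝ) < 1 / 24 by norm_num)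
    filter_upwards [this, eventually_gt_atTop 1200] with t ht ht'
    rw [Real.norm_eq_abs, id, Real.norm_of_nonneg (by linarith)] at ht
    linarith [le_abs_self (Real.log t)]
  have h1 := (Real.tendsto_log_atTop.comp tendsto_log_natCast).eventually hlog
  filter_upwards [h1, eventually_ge_atTop 3,
    (Real.tendsto_log_atTop.comp tendsto_log_natCast).eventually_gt_atTop 1] with n hn h3 ht1 y hy
  simp only [Function.comp] at hn ht1
  have hl := one_lt_log h3
  rcases le_or_gt y 1 with hy1 | hy1
  · by_contra hc
    push Not at hc
    have b := hy.2 hy1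
    set l := Real.log n with hldef
    have hl0 : 0 < l := by linarith
    have hlt : y < Real.log l / (9 * l) := by
      rw [rate, ← hldef] at hc
      calc y < 1 / 9 * (Real.log l / l) := hc
        _ = _ := by field_simp
    have hyl : y * l ≤ Real.log l / 9 := by
      rw [lt_div_iff₀ (by positivity)] at hlt
      linarith
    have hylog := Real.log_lt_log hy.1 hlt
    rw [Real.log_div (by linarith) (by positivity), Real.log_mul (by norm_num) hl0.ne'] at hylog
    have h9 : 0 ≤ Real.log 9 := Real.log_nonneg (by norm_num)
    nlinarith
  · linarith [rate_le_one h3]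

/-! ### Scaling -/

lemma eLpNorm_top_eq_of_isLUB {F : ℝ → ℂ} (hF : Continuous F) {c : ℝ}
    (hc : IsLUB (Set.range fun x => ‖F x‖) c) : eLpNorm F ⊤ volume = ENNReal.ofReal c := by
  have hle : ∀ x, ‖F x‖ ≤ c := fun x => hc.1 ⟨x, rfl⟩
  rw [eLpNorm_exponent_top]
  refine le_antisymm (eLpNormEssSup_le_of_ae_bound (Eventually.of_forall hle)) ?_
  -- By continuity the set where the essential supremum is exceeded is open; being null, it is
  -- empty.
  have hx : ∀ x, ‖F x‖ₑ ≤ eLpNormEssSup F volume := by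
    have h0 : volume {x | eLpNormEssSup F volume < ‖F x‖ₑ} = 0 := by
      simpa [ae_iff] using ae_le_eLpNormEssSup (f := F) (μ := volume)
    have ho : IsOpen {x | eLpNormEssSup F volume < ‖F x‖ₑ} :=
      isOpen_lt continuous_const hF.enorm
    have he := ho.measure_eq_zero_iff volume |>.1 h0
    intro x
    by_contra hlt
    have : x ∈ {x | eLpNormEssSup F volume < ‖F x‖ₑ} := not_le.1 hlt
    simp [he] at this
  by_contra hlt
  push Not at hlt
  have hfin : eLpNormEssSup F volume ≠ ⊤ := ne_top_of_lt hlt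
  have hub : c ≤ (eLpNormEssSup F volume).toReal := by
    refine hc.2 ?_
    rintro _ ⟨x, rfl⟩
    have := ENNReal.toReal_mono hfin (hx x)
    simpa using this
  exact absurd (ENNReal.ofReal_le_of_le_toReal hub) (not_le.2 hlt)

lemma ofReal_sub_ne_zero {a : ℂ} (ha : a.im ≠ 0) (x : ℝ) : (x : ℂ) - a ≠ 0 := by
  intro h
  have := congrArg Complex.im h
  simp at this
  exact ha this

lemma continuous_simpleFraction {n : ℕ} {z : Fin n → ℂ} (hz : ∀ k, (z k).im ≠ 0) :
    Continuous fun x : ℝ => simpleFraction z (x : ℂ) := by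
  unfold simpleFraction
  refine continuous_finsetSum _ fun k _ => Continuous.div (by fun_prop) (by fun_prop) ?_
  exact ofReal_sub_ne_zero (hz k)

/-- As `x → ∞`, `x ρ(x)` tends to the order `n`, which is not `0`. -/
lemma exists_simpleFraction_ne_zero {n : ℕ} (hn : 0 < n) (z : Fin n → ℂ) :
    ∃ x : ℝ, simpleFraction z (x : ℂ) ≠ 0 := by
  by_contra! hc
  have ht : ∀ k, Tendsto (fun x : ℝ => (x : ℂ) * (1 / ((x : ℂ) - z k))) atTop (𝓝 1) := by
    intro k
    have h1 : Tendsto (fun x : ℝ => 1 / (1 - z k * ((x⁻¹ : ℝ) : ℂ))) atTop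
        (𝓝 (1 / (1 - z k * ((0 : ℝ) : ℂ)))) := by
      refine Tendsto.div tendsto_const_nhds (tendsto_const_nhds.sub (Tendsto.const_mul _ ?_))
        (by simp)
      exact (Complex.continuous_ofReal.tendsto 0).comp tendsto_inv_atTop_zero
    simp only [Complex.ofReal_zero, mul_zero, sub_zero, div_one] at h1
    refine h1.congr' ?_
    filter_upwards [eventually_gt_atTop 0] with x hx
    have hx' : (x : ℂ) ≠ 0 := by exact_mod_cast hx.ne'
    have e : (x : ℂ) - z k = x * (1 - z k * ((x⁻¹ : ℝ) : ℂ)) := by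
      push_cast
      field_simp
    rw [e, one_div, one_div, mul_inv, mul_inv_cancel_left₀ hx']
  have hs := tendsto_finsetSum Finset.univ fun k _ => ht k
  have h0 : (fun x : ℝ => ∑ k, (x : ℂ) * (1 / ((x : ℂ) - z k))) = fun _ => 0 := by
    funext x
    rw [← Finset.mul_sum]
    have := hc x
    rw [simpleFraction] at this
    rw [this, mul_zero]
  rw [h0] at hs
  have := tendsto_nhds_unique hs tendsto_const_nhds
  simp at this
  omega

lemma simpleFraction_smul {n : ℕ} (z : Fin n → ℂ) {c : ℝ} (hc : c ≠ 0) (w : ℂ) :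
    simpleFraction (fun k => (c : ℂ) * z k) (c * w) = (c : ℂ)⁻¹ * simpleFraction z w := by
  have hc' : (c : ℂ) ≠ 0 := by exact_mod_cast hc
  simp only [simpleFraction, Finset.mul_sum]
  refine Finset.sum_congr rfl fun k _ => ?_
  rw [← mul_sub, one_div, one_div, mul_inv]

/-- Multiplying the poles by `c` divides the norm by `c`; take `c` to be the supremum itself, which
is positive. -/
lemma exists_scale {n : ℕ} (hn : 0 < n) {z : Fin n → ℂ} (hz : ∀ k, (z k).im ≠ 0) {M : ℝ}
    (hM : ∀ x : ℝ, ‖simpleFraction z (x : ℂ)‖ ≤ M) :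
    ∃ c : ℝ, 0 < c ∧ c ≤ M ∧
      eLpNorm (fun x : ℝ => simpleFraction (fun k => (c : ℂ) * z k) (x : ℂ)) ⊤ volume = 1 := by
  have hbdd : BddAbove (Set.range fun x : ℝ => ‖simpleFraction z (x : ℂ)‖) :=
    ⟨M, by rintro _ ⟨x, rfl⟩; exact hM x⟩
  have hlub := isLUB_ciSup hbdd
  set c := ⨆ x : ℝ, ‖simpleFraction z (x : ℂ)‖ with hc
  obtain ⟨x₀, hx₀⟩ := exists_simpleFraction_ne_zero hn z
  have hc0 : 0 < c := (norm_pos_iff.2 hx₀).trans_le (hlub.1 ⟨x₀, rfl⟩)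
  refine ⟨c, hc0, ciSup_le hM, ?_⟩
  have hcont : Continuous fun x : ℝ => simpleFraction (fun k => (c : ℂ) * z k) (x : ℂ) :=
    continuous_simpleFraction fun k => by simp [hc0.ne', hz k]
  have hsc : ∀ x : ℝ, ‖simpleFraction (fun k => (c : ℂ) * z k) ((c * x : ℝ) : ℂ)‖ =
      c⁻¹ * ‖simpleFraction z (x : ℂ)‖ := by
    intro x
    rw [Complex.ofReal_mul, simpleFraction_smul z hc0.ne', norm_mul, norm_inv,
      Complex.norm_real, Real.norm_of_nonneg hc0.le]
  rw [eLpNorm_top_eq_of_isLUB hcont (c := 1), ENNReal.ofReal_one]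
  constructor
  · rintro _ ⟨x, rfl⟩
    have e : x = c * (x / c) := by field_simp
    change ‖simpleFraction (fun k => (c : ℂ) * z k) (x : ℂ)‖ ≤ 1
    rw [e, hsc, inv_mul_le_one₀ hc0]
    exact hlub.1 ⟨x / c, rfl⟩
  · intro b hb
    have : c ≤ c * b := by
      refine hlub.2 ?_
      rintro _ ⟨x, rfl⟩
      have := hb ⟨c * x, rfl⟩
      simp only [hsc] at this
      rwa [inv_mul_le_iff₀ hc0] at this
    nlinarith

lemma minAbsIm_nonneg {n : ℕ} (z : Fin n → ℂ) : 0 ≤ minAbsIm z :=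
  Real.iInf_nonneg fun _ => abs_nonneg _

lemma minAbsIm_smul_le {n : ℕ} (z : Fin n → ℂ) {c : ℝ} (hc : 0 < c) (k : Fin n) :
    minAbsIm (fun k => (c : ℂ) * z k) ≤ c * |(z k).im| := by
  refine (ciInf_le (Set.finite_range _).bddBelow k).trans_eq ?_
  simp [abs_mul, abs_of_pos hc]

lemma gorinDist_le {n : ℕ} {z : Fin n → ℂ} (hz : ∀ k, (z k).im ≠ 0) {M y : ℝ}
    (hM : ∀ x : ℝ, ‖simpleFraction z (x : ℂ)‖ ≤ M) (k : Fin n) (hk : |(z k).im| ≤ y) :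
    gorinDist n ≤ M * y := by
  obtain ⟨c, hc0, hcM, hc⟩ := exists_scale (Fin.pos k) hz hM
  have hb : BddBelow {y : ℝ | ∃ z : Fin n → ℂ, (∀ k, (z k).im ≠ 0) ∧
      eLpNorm (fun x : ℝ => simpleFraction z (x : ℂ)) ⊤ volume = 1 ∧ y = minAbsIm z} :=
    ⟨0, by rintro _ ⟨z, -, -, rfl⟩; exact minAbsIm_nonneg z⟩
  refine (csInf_le hb ⟨_, fun k => ?_, hc, rfl⟩).trans ((minAbsIm_smul_le z hc0 k).trans ?_)
  · simp [hc0.ne', hz k]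
  · exact mul_le_mul hcM hk (abs_nonneg _) (hc0.le.trans hcM)

/-- The fraction with poles `w j` below the line serves as the `H_∞` correction. Only norm at most
`1` is required, so scaling by the bound `M` suffices. -/
lemma gorinHardyDist_le {n : ℕ} {z : Fin n → ℂ} (hz : ∀ k, 0 < (z k).im) {κ : Type*}
    (s : Finset κ) {w : κ → ℂ} (hw : ∀ j ∈ s, (w j).im < 0) {M y : ℝ} (hM0 : 0 < M)
    (hM : ∀ x : ℝ, ‖simpleFraction z (x : ℂ) + ∑ j ∈ s, 1 / ((x : ℂ) - w j)‖ ≤ M)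
    (k : Fin n) (hk : (z k).im ≤ y) : gorinHardyDist n ≤ M * y := by
  have hb : BddBelow {y : ℝ | ∃ z : Fin n → ℂ, (∀ k, 0 < (z k).im) ∧
      (∃ (f : ℂ → ℂ) (g : ℝ → ℂ), IsHInfty f ∧ IsBoundaryFunction f g ∧
        eLpNorm (fun x : ℝ => simpleFraction z (x : ℂ) + g x) ⊤ volume ≤ 1) ∧
      y = minAbsIm z} :=
    ⟨0, by rintro _ ⟨z, -, -, rfl⟩; exact minAbsIm_nonneg z⟩
  have hw' : ∀ j ∈ s, ((M : ℂ) * w j).im < 0 := by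
    intro j hj
    simpa using mul_neg_of_pos_of_neg hM0 (hw j hj)
  refine (csInf_le hb ⟨fun k => (M : ℂ) * z k, fun k => ?_, ⟨_, _, isHInfty_sum s hw',
    isBoundaryFunction_sum s hw', ?_⟩, rfl⟩).trans ((minAbsIm_smul_le z hM0 k).trans ?_)
  · simpa using mul_pos hM0 (hz k)
  · rw [eLpNorm_exponent_top]
    refine (eLpNormEssSup_le_of_ae_bound (C := 1) (Eventually.of_forall fun x => ?_)).trans
      (by simp)
    have e : (x : ℂ) = M * ((x / M : ℝ) : ℂ) := by
      push_cast
      rw [mul_div_cancel₀]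
      exact_mod_cast hM0.ne'
    have e2 : ∑ j ∈ s, 1 / ((x : ℂ) - M * w j) =
        (M : ℂ)⁻¹ * ∑ j ∈ s, 1 / (((x / M : ℝ) : ℂ) - w j) := by
      rw [Finset.mul_sum]
      refine Finset.sum_congr rfl fun j _ => ?_
      rw [e, ← mul_sub, one_div, one_div, mul_inv]
    rw [e2, e, simpleFraction_smul z hM0.ne', ← mul_add, norm_mul, norm_inv, Complex.norm_real,
      Real.norm_of_nonneg hM0.le, inv_mul_le_one₀ hM0]
    exact hM _
  · rw [abs_of_pos (hz k)]
    exact mul_le_mul_of_nonneg_left hk hM0.le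

/-! ### Simple fractions with a low pole -/

open Polynomial in
/-- The monic polynomial with zeros `σ i, 2 σ i, …, m σ i`. -/
def ladder (m : ℕ) (σ : ℂ) : ℂ[X] :=
  ∏ k ∈ Finset.range m, (X - C (σ * ((k : ℂ) + 1) * Complex.I))

lemma eval_ladder (m : ℕ) (σ w : ℂ) :
    (ladder m σ).eval w = ∏ k ∈ Finset.range m, (w - σ * ((k : ℂ) + 1) * Complex.I) := by
  simp [ladder, Polynomial.eval_prod]

lemma monic_ladder (m : ℕ) (σ : ℂ) : (ladder m σ).Monic :=
  Polynomial.monic_prod_of_monic _ _ fun _ _ => Polynomial.monic_X_sub_C _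

lemma natDegree_ladder (m : ℕ) (σ : ℂ) : (ladder m σ).natDegree = m := by
  rw [ladder, Polynomial.natDegree_prod_of_monic _ _ fun _ _ => Polynomial.monic_X_sub_C _]
  simp only [Polynomial.natDegree_X_sub_C, Finset.sum_const, Finset.card_range, smul_eq_mul,
    mul_one]

lemma eval_derivative_ladder (m : ℕ) (σ : ℂ) {w : ℂ}
    (hw : ∀ k : ℕ, w - σ * ((k : ℂ) + 1) * Complex.I ≠ 0) :
    (ladder m σ).derivative.eval w = (ladder m σ).eval w *
      ∑ k ∈ Finset.range m, 1 / (w - σ * ((k : ℂ) + 1) * Complex.I) := by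
  rw [eval_ladder, ladder, Polynomial.derivative_prod_finset, Polynomial.eval_finsetSum,
    Finset.mul_sum]
  refine Finset.sum_congr rfl fun k hk => ?_
  rw [← Finset.mul_prod_erase _ _ hk]
  have := hw k
  simp only [Polynomial.eval_prod, Polynomial.eval_sub, Polynomial.eval_X, Polynomial.eval_C,
    Polynomial.derivative_sub, Polynomial.derivative_X, Polynomial.derivative_C, sub_zero, mul_one]
  rw [mul_one_div, mul_div_cancel_left₀ _ this]

/-- The polynomial whose zeros are the upper poles of the extremal simple fraction. -/
def lowPoly (m : ℕ) (δ : ℂ) : Polynomial ℂ :=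
  ladder m 1 - Polynomial.C δ * ladder m (-1)

lemma natDegree_lowPoly (m : ℕ) {δ : ℂ} (hδ : ‖δ‖ < 1) : (lowPoly m δ).natDegree = m := by
  have c1 : (ladder m 1).coeff m = 1 := by
    have := (monic_ladder m 1).coeff_natDegree
    rwa [natDegree_ladder] at this
  have c2 : (ladder m (-1)).coeff m = 1 := by
    have := (monic_ladder m (-1)).coeff_natDegree
    rwa [natDegree_ladder] at this
  refine Polynomial.natDegree_eq_of_le_of_coeff_ne_zero ?_ ?_
  · refine (Polynomial.natDegree_sub_le _ _).trans (max_le (natDegree_ladder m 1).le ?_)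
    exact (Polynomial.natDegree_C_mul_le _ _).trans (natDegree_ladder m (-1)).le
  · rw [lowPoly, Polynomial.coeff_sub, Polynomial.coeff_C_mul, c1, c2, mul_one, sub_ne_zero]
    rintro rfl
    simp at hδ

lemma card_roots_lowPoly (m : ℕ) {δ : ℂ} (hδ : ‖δ‖ < 1) :
    Multiset.card (lowPoly m δ).roots = m := by
  rw [← (IsAlgClosed.splits _).natDegree_eq_card_roots, natDegree_lowPoly m hδ]

/-- Factor by factor: a point of the closed lower half-plane is no farther from `-(k+1)i` than from
`(k+1)i`. This keeps the zeros of `lowPoly` above the line. -/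
lemma norm_eval_ladder_le (m : ℕ) {w : ℂ} (hw : w.im ≤ 0) :
    ‖(ladder m (-1)).eval w‖ ≤ ‖(ladder m 1).eval w‖ := by
  rw [eval_ladder, eval_ladder, norm_prod, norm_prod]
  refine Finset.prod_le_prod (fun _ _ => norm_nonneg _) fun k _ => ?_
  apply le_of_sq_le_sq _ (norm_nonneg _)
  rw [Complex.sq_norm, Complex.sq_norm, Complex.normSq_apply, Complex.normSq_apply]
  simp
  have : (0 : ℝ) ≤ k := by positivity
  nlinarith

lemma eval_ladder_one_ne_zero (m : ℕ) {w : ℂ} (hw : w.im ≤ 0) : (ladder m 1).eval w ≠ 0 := by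
  rw [eval_ladder, Finset.prod_ne_zero_iff]
  intro k _ h
  have := congrArg Complex.im h
  simp at this
  have : (0 : ℝ) ≤ k := by positivity
  linarith

lemma norm_eval_lowPoly_ge (m : ℕ) {δ w : ℂ} (hw : w.im ≤ 0) :
    (1 - ‖δ‖) * ‖(ladder m 1).eval w‖ ≤ ‖(lowPoly m δ).eval w‖ := by
  rw [lowPoly, Polynomial.eval_sub, Polynomial.eval_mul, Polynomial.eval_C]
  have h1 := norm_sub_norm_le ((ladder m 1).eval w) (δ * (ladder m (-1)).eval w)
  rw [norm_mul] at h1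
  have h2 := mul_le_mul_of_nonneg_left (norm_eval_ladder_le m hw) (norm_nonneg δ)
  linarith

lemma eval_lowPoly_ne_zero (m : ℕ) {δ w : ℂ} (hδ : ‖δ‖ < 1) (hw : w.im ≤ 0) :
    (lowPoly m δ).eval w ≠ 0 := by
  have h1 := norm_eval_lowPoly_ge m (δ := δ) hw
  have h2 := norm_pos_iff.2 (eval_ladder_one_ne_zero m hw)
  apply norm_pos_iff.1
  nlinarith

lemma im_pos_of_mem_roots (m : ℕ) {δ w : ℂ} (hδ : ‖δ‖ < 1) (hw : w ∈ (lowPoly m δ).roots) :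
    0 < w.im := by
  by_contra hc
  exact eval_lowPoly_ne_zero m hδ (not_lt.1 hc) (Polynomial.isRoot_of_mem_roots hw)

/-- With `u = y / k`, this is `log ((1 + u) / (1 - u)) ≥ 2u`, the first term of the series. -/
lemma sub_le_add_mul_exp {k y : ℝ} (hk : 0 < k) (hy : 0 ≤ y) (hyk : y < k) :
    k - y ≤ (k + y) * Real.exp (-2 * y * (1 / k)) := by
  set u := y / k with hu
  have hu0 : 0 ≤ u := by positivity
  have hu1 : u < 1 := by rw [hu, div_lt_one hk]; exact hyk
  have hs := Real.hasSum_log_sub_log_of_abs_lt_one (x := u) (by rwa [abs_of_nonneg hu0])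
  have h0 := le_hasSum hs 0 fun j _ => by positivity
  simp at h0
  have h1 : Real.log (1 - u) ≤ Real.log (1 + u) + -2 * u := by linarith
  have h2 := Real.exp_le_exp.2 h1
  rw [Real.exp_add, Real.exp_log (by linarith), Real.exp_log (by linarith)] at h2
  have e1 : k - y = k * (1 - u) := by rw [hu]; field_simp
  have e2 : k + y = k * (1 + u) := by rw [hu]; field_simp
  have e3 : -2 * y * (1 / k) = -2 * u := by rw [hu]; ring
  rw [e1, e2, e3, mul_assoc]
  exact mul_le_mul_of_nonneg_left h2 hk.le

/-- The harmonic sum `1 + 1 / 2 + ⋯ + 1 / m`. -/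
def harm (m : ℕ) : ℝ := ∑ k ∈ Finset.range m, 1 / ((k : ℝ) + 1)

lemma harm_eq_harmonic (m : ℕ) : harm m = (harmonic m : ℝ) := by
  simp [harm, harmonic]

/-- The sign `(-1) ^ m` makes `lowPoly` on the imaginary axis a constant multiple of the real
function `q`. There `q 0 = (1 - ε) m! ≥ 0`, while the hypothesis on `y` gives `q y ≤ 0`, so the
intermediate value theorem applies. -/
lemma exists_low_root (m : ℕ) {ε y : ℝ} (hε1 : ε < 1) (hε0 : 0 < ε) (hy0 : 0 ≤ y) (hy1 : y < 1)
    (hy : Real.exp (-2 * y * harm m) ≤ ε) :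
    ∃ w ∈ (lowPoly m ((-1) ^ m * (ε : ℂ))).roots, w.im ≤ y := by
  set q : ℝ → ℝ := fun t => ∏ k ∈ Finset.range m, ((k : ℝ) + 1 - t) -
    ε * ∏ k ∈ Finset.range m, ((k : ℝ) + 1 + t) with hq
  have hqc : Continuous q := by rw [hq]; fun_prop
  have hq0 : 0 ≤ q 0 := by
    simp only [hq, sub_zero, add_zero]
    have : 0 < ∏ k ∈ Finset.range m, ((k : ℝ) + 1) := Finset.prod_pos fun k _ => by positivity
    nlinarith
  have hqy : q y ≤ 0 := by
    simp only [hq, sub_nonpos]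
    have h1 : ∏ k ∈ Finset.range m, ((k : ℝ) + 1 - y) ≤
        ∏ k ∈ Finset.range m, (((k : ℝ) + 1 + y) * Real.exp (-2 * y * (1 / ((k : ℝ) + 1)))) := by
      refine Finset.prod_le_prod (fun k _ => ?_) fun k _ => ?_
      · have : (0 : ℝ) ≤ k := by positivity
        linarith
      · exact sub_le_add_mul_exp (by positivity) hy0
          (by have : (0 : ℝ) ≤ k := by positivity
              linarith)
    rw [Finset.prod_mul_distrib, ← Real.exp_sum, ← Finset.mul_sum] at h1
    have h2 : 0 ≤ ∏ k ∈ Finset.range m, ((k : ℝ) + 1 + y) :=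
      Finset.prod_nonneg fun k _ => by positivity
    refine h1.trans ?_
    rw [mul_comm]
    exact mul_le_mul_of_nonneg_right hy h2
  obtain ⟨t, ht, hqt⟩ := intermediate_value_Icc' hy0 hqc.continuousOn ⟨hqy, hq0⟩
  have hδ : ‖(-1 : ℂ) ^ m * (ε : ℂ)‖ < 1 := by
    simp [abs_of_pos hε0, hε1]
  have hne : lowPoly m ((-1) ^ m * (ε : ℂ)) ≠ 0 := by
    intro h
    have := eval_lowPoly_ne_zero m hδ (w := 0) (by simp)
    simp [h] at this
  refine ⟨t * Complex.I, (Polynomial.mem_roots hne).2 ?_, by simpa using ht.2⟩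
  have e1 : (ladder m 1).eval (t * Complex.I) =
      (-Complex.I) ^ m * ((∏ k ∈ Finset.range m, ((k : ℝ) + 1 - t) : ℝ) : ℂ) := by
    rw [eval_ladder, Complex.ofReal_prod]
    nth_rw 2 [← Finset.card_range m]
    rw [← Finset.prod_const, ← Finset.prod_mul_distrib]
    refine Finset.prod_congr rfl fun k _ => ?_
    push_cast
    ring
  have e2 : (ladder m (-1)).eval (t * Complex.I) =
      Complex.I ^ m * ((∏ k ∈ Finset.range m, ((k : ℝ) + 1 + t) : ℝ) : ℂ) := by
    rw [eval_ladder, Complex.ofReal_prod]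
    nth_rw 2 [← Finset.card_range m]
    rw [← Finset.prod_const, ← Finset.prod_mul_distrib]
    refine Finset.prod_congr rfl fun k _ => ?_
    push_cast
    ring
  have e3 : (-Complex.I) ^ m = (-1) ^ m * Complex.I ^ m := by rw [← mul_pow]; simp
  rw [Polynomial.IsRoot, lowPoly, Polynomial.eval_sub, Polynomial.eval_mul, Polynomial.eval_C,
    e1, e2, e3]
  have : ((q t : ℝ) : ℂ) = 0 := by rw [hqt]; simp
  simp only [hq, Complex.ofReal_sub, Complex.ofReal_mul] at this
  linear_combination (-1) ^ m * Complex.I ^ m * this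

/-! ### The norm on the real line -/

lemma sub_div_le_arctan_sub {a b : ℝ} (ha : 0 ≤ a) (hab : a < b) :
    (b - a) / (1 + b ^ 2) ≤ Real.arctan b - Real.arctan a := by
  obtain ⟨c, hc, hc'⟩ := exists_hasDerivAt_eq_slope Real.arctan (fun x => 1 / (1 + x ^ 2)) hab
    Real.continuous_arctan.continuousOn fun x _ => Real.hasDerivAt_arctan x
  have hba : 0 < b - a := by linarith
  rw [eq_div_iff hba.ne'] at hc'
  rw [← hc', div_eq_mul_one_div, mul_comm]
  have := hc.1
  have := hc.2
  gcongr
  linarith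

/-- A lower Riemann sum for the integral of `2x / (x² + s²)` over `s > 0`, telescoped through `2
arctan (s / x)`. -/
lemma sum_div_le_pi (m : ℕ) {x : ℝ} (hx : 0 ≤ x) :
    ∑ k ∈ Finset.range m, 2 * x / (x ^ 2 + ((k : ℝ) + 1) ^ 2) ≤ Real.pi := by
  rcases hx.eq_or_lt with rfl | hx
  · simp [Real.pi_pos.le]
  have h : ∀ k ∈ Finset.range m, 2 * x / (x ^ 2 + ((k : ℝ) + 1) ^ 2) ≤
      2 * Real.arctan (((k + 1 : ℕ) : ℝ) / x) - 2 * Real.arctan ((k : ℝ) / x) := by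
    intro k _
    have := sub_div_le_arctan_sub (a := (k : ℝ) / x) (b := ((k : ℝ) + 1) / x) (by positivity)
      (by gcongr; linarith)
    have e : (((k : ℝ) + 1) / x - k / x) / (1 + (((k : ℝ) + 1) / x) ^ 2) =
        x / (x ^ 2 + ((k : ℝ) + 1) ^ 2) := by
      field_simp
      ring
    rw [e] at this
    push_cast
    rw [mul_div_assoc]
    linarith
  refine (Finset.sum_le_sum h).trans ?_
  rw [Finset.sum_range_sub (fun k : ℕ => 2 * Real.arctan ((k : ℝ) / x))]
  have := Real.arctan_lt_pi_div_two ((m : ℝ) / x)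
  simp
  linarith

/-- The sum over the roots is the logarithmic derivative of `lowPoly`. Adding the lower ladder
leaves the symmetric sum `α + β`, bounded by `π`, and a remainder carrying the factor `δ`. -/
lemma norm_sum_roots_add_le (m : ℕ) {δ : ℂ} (hδ : ‖δ‖ < 1) (x : ℝ) :
    ‖((lowPoly m δ).roots.map fun a => 1 / ((x : ℂ) - a)).sum +
        ∑ k ∈ Finset.range m, 1 / ((x : ℂ) - -1 * ((k : ℂ) + 1) * Complex.I)‖ ≤
      Real.pi + 2 * ‖δ‖ * harm m / (1 - ‖δ‖) := by
  have hne : ∀ σ : ℂ, σ = 1 ∨ σ = -1 → ∀ k : ℕ, (x : ℂ) - σ * ((k : ℂ) + 1) * Complex.I ≠ 0 := by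
    rintro σ hσ k
    apply ofReal_sub_ne_zero
    have : (k : ℝ) + 1 ≠ 0 := by positivity
    rcases hσ with rfl | rfl
    · simpa using this
    · intro h
      simp at h
      exact this (by linarith)
  set α := ∑ k ∈ Finset.range m, 1 / ((x : ℂ) - -1 * ((k : ℂ) + 1) * Complex.I) with hα
  set β := ∑ k ∈ Finset.range m, 1 / ((x : ℂ) - 1 * ((k : ℂ) + 1) * Complex.I) with hβ
  set e₁ := (ladder m 1).eval (x : ℂ) with he₁
  set e₂ := (ladder m (-1)).eval (x : ℂ) with he₂
  have hx0 : ((x : ℂ)).im ≤ 0 := by simp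
  have hQ := eval_lowPoly_ne_zero m hδ hx0
  have hQe : (lowPoly m δ).eval (x : ℂ) = e₁ - δ * e₂ := by simp [lowPoly, he₁, he₂]
  have hQ' : (lowPoly m δ).derivative.eval (x : ℂ) = e₁ * β - δ * (e₂ * α) := by
    simp only [lowPoly, Polynomial.derivative_sub, Polynomial.derivative_C_mul,
      Polynomial.eval_sub, Polynomial.eval_mul, Polynomial.eval_C]
    rw [eval_derivative_ladder m 1 (hne 1 (Or.inl rfl)),
      eval_derivative_ladder m (-1) (hne (-1) (Or.inr rfl))]
  rw [← (IsAlgClosed.splits _).eval_derivative_div_eval_of_ne_zero hQ, hQe, hQ']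
  rw [hQe] at hQ
  have e : (e₁ * β - δ * (e₂ * α)) / (e₁ - δ * e₂) + α =
      (α + β) + δ * (β - α) * (e₂ / (e₁ - δ * e₂)) := by
    field_simp
    ring
  rw [e]
  have hab : ∀ k : ℕ, 1 / ((x : ℂ) - -1 * ((k : ℂ) + 1) * Complex.I) +
      1 / ((x : ℂ) - 1 * ((k : ℂ) + 1) * Complex.I) =
      ((2 * x / (x ^ 2 + ((k : ℝ) + 1) ^ 2) : ℝ) : ℂ) ∧
      1 / ((x : ℂ) - 1 * ((k : ℂ) + 1) * Complex.I) -
      1 / ((x : ℂ) - -1 * ((k : ℂ) + 1) * Complex.I) =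
      ((2 * ((k : ℝ) + 1) / (x ^ 2 + ((k : ℝ) + 1) ^ 2) : ℝ) : ℂ) * Complex.I := by
    intro k
    have n1 := hne 1 (Or.inl rfl) k
    have n2 := hne (-1) (Or.inr rfl) k
    have hp : ((x : ℂ) - -1 * ((k : ℂ) + 1) * Complex.I) *
        ((x : ℂ) - 1 * ((k : ℂ) + 1) * Complex.I) = (x : ℂ) ^ 2 + ((k : ℂ) + 1) ^ 2 := by
      linear_combination (-((k : ℂ) + 1) ^ 2) * Complex.I_sq
    constructor
    · rw [div_add_div _ _ n2 n1, hp]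
      push_cast
      congr 1
      ring
    · rw [div_sub_div _ _ n1 n2, mul_comm ((x : ℂ) - 1 * ((k : ℂ) + 1) * Complex.I)
        ((x : ℂ) - -1 * ((k : ℂ) + 1) * Complex.I), hp]
      push_cast
      rw [div_mul_eq_mul_div]
      congr 1
      ring
  have hsum : ‖α + β‖ ≤ Real.pi := by
    rw [hα, hβ, ← Finset.sum_add_distrib]
    refine (norm_sum_le _ _).trans (le_trans (Finset.sum_le_sum fun k _ => ?_)
      (sum_div_le_pi m (abs_nonneg x)))
    rw [(hab k).1, Complex.norm_real, Real.norm_eq_abs, abs_div, abs_mul, abs_two, sq_abs,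
      abs_of_pos (show 0 < x ^ 2 + ((k : ℝ) + 1) ^ 2 by positivity)]
  have hdiff : ‖β - α‖ ≤ 2 * harm m := by
    rw [hα, hβ, ← Finset.sum_sub_distrib, harm, Finset.mul_sum]
    refine (norm_sum_le _ _).trans (Finset.sum_le_sum fun k _ => ?_)
    rw [(hab k).2, norm_mul, Complex.norm_I, mul_one, Complex.norm_real,
      Real.norm_of_nonneg (by positivity), mul_one_div,
      div_le_div_iff₀ (by positivity) (by positivity)]
    nlinarith [sq_nonneg x, show (0 : ℝ) ≤ k by positivity]
  have hδ1 : 0 < 1 - ‖δ‖ := by linarith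
  have hq : ‖e₂ / (e₁ - δ * e₂)‖ ≤ 1 / (1 - ‖δ‖) := by
    have h1 := norm_eval_lowPoly_ge m (δ := δ) hx0
    rw [hQe] at h1
    have h2 := norm_eval_ladder_le m hx0
    rw [norm_div, div_le_div_iff₀ (norm_pos_iff.2 hQ) hδ1]
    nlinarith
  refine (norm_add_le _ _).trans (add_le_add hsum ?_)
  rw [norm_mul, norm_mul]
  calc ‖δ‖ * ‖β - α‖ * ‖e₂ / (e₁ - δ * e₂)‖ ≤ ‖δ‖ * (2 * harm m) * (1 / (1 - ‖δ‖)) := by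
        have : 0 ≤ harm m := Finset.sum_nonneg fun k _ => by positivity
        gcongr
    _ = _ := by ring

/-! ### The upper bounds -/

lemma exists_poles_of_multiset {n : ℕ} (S : Multiset ℂ) (hS : Multiset.card S = n) :
    ∃ z : Fin n → ℂ, (∀ k, z k ∈ S) ∧ (∀ a ∈ S, ∃ k, z k = a) ∧
      ∀ w, simpleFraction z w = (S.map fun a => 1 / (w - a)).sum := by
  subst hS
  induction S using Quotient.inductionOn with
  | h l =>
    refine ⟨fun k => l.get k, fun k => List.get_mem l k, fun a ha => ?_, fun w => ?_⟩
    · obtain ⟨k, hk⟩ := List.mem_iff_get.1 (show a ∈ l from ha)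
      exact ⟨k, hk⟩
    · simp only [simpleFraction, Multiset.quot_mk_to_coe, Multiset.map_coe, Multiset.sum_coe]
      conv_rhs => rw [← List.ofFn_get l, List.map_ofFn, List.sum_ofFn]
      rfl

/-- Poles at height `100 n` bring the order up to `n` at negligible cost. -/
lemma norm_far_le (n N : ℕ) (hn : 0 < n) (hN : N ≤ n) (x : ℝ) :
    ‖((Multiset.replicate N (((100 * n : ℝ) : ℂ) * Complex.I)).map
      fun a => 1 / ((x : ℂ) - a)).sum‖ ≤ 1 / 100 := by
  rw [Multiset.map_replicate, Multiset.sum_replicate, nsmul_eq_mul, norm_mul, norm_div, norm_one,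
    Complex.norm_natCast]
  have hn' : (0 : ℝ) < n := by exact_mod_cast hn
  have h1 : 100 * (n : ℝ) ≤ ‖(x : ℂ) - ((100 * n : ℝ) : ℂ) * Complex.I‖ := by
    have := Complex.abs_im_le_norm ((x : ℂ) - ((100 * n : ℝ) : ℂ) * Complex.I)
    simpa [abs_of_pos hn'] using this
  rw [mul_one_div, div_le_div_iff₀ (lt_of_lt_of_le (by positivity) h1) (by norm_num)]
  have : (N : ℝ) ≤ n := by exact_mod_cast hN
  linarith

lemma neg_ladder_im (k : ℕ) : (-1 * ((k : ℂ) + 1) * Complex.I).im < 0 := by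
  simp
  have : (0 : ℝ) ≤ k := by positivity
  linarith

lemma gorinDist_le_of_lowPoly {n m : ℕ} (hn : 0 < n) (hm : 2 * m ≤ n) {ε y : ℝ} (hε0 : 0 < ε)
    (hε1 : ε < 1) (hy0 : 0 ≤ y) (hy1 : y < 1) (hy : Real.exp (-2 * y * harm m) ≤ ε) :
    gorinDist n ≤ (Real.pi + 2 * ε * harm m / (1 - ε) + 1 / 100) * y := by
  set δ : ℂ := (-1) ^ m * (ε : ℂ) with hδdef
  have hδn : ‖δ‖ = ε := by simp [hδdef, abs_of_pos hε0]
  have hδ : ‖δ‖ < 1 := by rwa [hδn]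
  obtain ⟨a, ha, hay⟩ := exists_low_root m hε1 hε0 hy0 hy1 hy
  obtain ⟨z, hzS, hSz, hz⟩ := exists_poles_of_multiset (n := n)
    ((lowPoly m δ).roots + (Multiset.range m).map (fun k : ℕ => -1 * ((k : ℂ) + 1) * Complex.I) +
      Multiset.replicate (n - 2 * m) (((100 * n : ℝ) : ℂ) * Complex.I)) (by
    simp [card_roots_lowPoly m hδ]
    omega)
  obtain ⟨k, hk⟩ := hSz a (Multiset.mem_add.2 (Or.inl (Multiset.mem_add.2 (Or.inl ha))))
  refine gorinDist_le (z := z) (fun k => ?_) (fun x => ?_) k ?_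
  · have := hzS k
    rw [Multiset.mem_add, Multiset.mem_add, Multiset.mem_map] at this
    rcases this with (h | ⟨j, -, h⟩) | h
    · exact (im_pos_of_mem_roots m hδ h).ne'
    · rw [← h]
      exact (neg_ladder_im j).ne
    · rw [Multiset.eq_of_mem_replicate h]
      simpa using hn.ne'
  · rw [hz, Multiset.map_add, Multiset.sum_add, Multiset.map_add, Multiset.sum_add,
      Multiset.map_map]
    refine (norm_add_le _ _).trans (add_le_add ?_ (norm_far_le n _ hn (by omega) x))
    have := norm_sum_roots_add_le m hδ x
    rwa [hδn] at this
  · rw [hk, abs_of_pos (im_pos_of_mem_roots m hδ ha)]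
    exact hay

lemma gorinHardyDist_le_of_lowPoly {n m : ℕ} (hn : 0 < n) (hm : 2 * m ≤ n) {ε y : ℝ} (hε0 : 0 < ε)
    (hε1 : ε < 1) (hy0 : 0 ≤ y) (hy1 : y < 1) (hy : Real.exp (-2 * y * harm m) ≤ ε) :
    gorinHardyDist n ≤ (Real.pi + 2 * ε * harm m / (1 - ε) + 1 / 100) * y := by
  set δ : ℂ := (-1) ^ m * (ε : ℂ) with hδdef
  have hδn : ‖δ‖ = ε := by simp [hδdef, abs_of_pos hε0]
  have hδ : ‖δ‖ < 1 := by rwa [hδn]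
  obtain ⟨a, ha, hay⟩ := exists_low_root m hε1 hε0 hy0 hy1 hy
  -- The lower ladder is now the correction in `H_∞` and uses no poles, so `n - m` distant ones are
  -- added.
  obtain ⟨z, hzS, hSz, hz⟩ := exists_poles_of_multiset (n := n)
    ((lowPoly m δ).roots +
      Multiset.replicate (n - m) (((100 * n : ℝ) : ℂ) * Complex.I)) (by
    simp [card_roots_lowPoly m hδ]
    omega)
  obtain ⟨k, hk⟩ := hSz a (Multiset.mem_add.2 (Or.inl ha))
  have hh : 0 ≤ harm m := Finset.sum_nonneg fun k _ => by positivity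
  have hε : 0 < 1 - ε := by linarith
  refine gorinHardyDist_le (z := z) (fun k => ?_) (Finset.range m)
    (w := fun k : ℕ => -1 * ((k : ℂ) + 1) * Complex.I) (fun j _ => neg_ladder_im j) (by positivity)
    (fun x => ?_) k (hk ▸ hay)
  · rcases Multiset.mem_add.1 (hzS k) with h | h
    · exact im_pos_of_mem_roots m hδ h
    · rw [Multiset.eq_of_mem_replicate h]
      simpa using hn
  · rw [hz, Multiset.map_add, Multiset.sum_add, add_right_comm]
    refine (norm_add_le _ _).trans (add_le_add ?_ (norm_far_le n _ hn (by omega) x))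
    have := norm_sum_roots_add_le m hδ x
    rwa [hδn] at this

/-- The parameters of the extremal simple fraction for large `n`. -/
lemma eventually_exists_params : ∀ᶠ n : ℕ in atTop, ∃ ε y : ℝ, 0 < ε ∧ ε < 1 ∧ 0 ≤ y ∧ y < 1 ∧
    Real.exp (-2 * y * harm (n / 2)) ≤ ε ∧
    (Real.pi + 2 * ε * harm (n / 2) / (1 - ε) + 1 / 100) * y ≤ 2 * rate n := by
  filter_upwards [eventually_ge_atTop 3, tendsto_log_natCast.eventually_gt_atTop 10,
    (Real.tendsto_log_atTop.comp tendsto_log_natCast).eventually_gt_atTop 48] with n h3 hl ht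
  simp only [Function.comp] at ht
  set l := Real.log n with hldef
  set t := Real.log l with htdef
  have hn : (3 : ℝ) ≤ n := by exact_mod_cast h3
  have hl0 : 0 < l := by linarith
  have hlog2 := Real.log_two_lt_d9
  have hlog2' := Real.log_two_gt_d9
  have hH1 : harm (n / 2) ≤ 1 + l := by
    rw [harm_eq_harmonic]
    refine (harmonic_le_one_add_log _).trans ?_
    have : Real.log ((n / 2 : ℕ) : ℝ) ≤ l := by
      refine Real.log_le_log ?_ ?_
      · have : 0 < n / 2 := by omega
        exact_mod_cast this
      · exact_mod_cast Nat.div_le_self n 2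
    linarith
  have hH2 : l - Real.log 2 ≤ harm (n / 2) := by
    rw [harm_eq_harmonic]
    refine le_trans ?_ (log_add_one_le_harmonic _)
    rw [hldef, ← Real.log_div (by positivity) (by norm_num)]
    refine Real.log_le_log (by positivity) ?_
    have : n ≤ 2 * (n / 2 + 1) := by omega
    have : (n : ℝ) ≤ 2 * (((n / 2 : ℕ) : ℝ) + 1) := by exact_mod_cast this
    push_cast
    linarith
  set Λ := 1 + l with hΛ
  have hΛ0 : 0 < Λ := by linarith
  have hlΛ : Real.log (100 * Λ) ≤ t + 6 := by
    have h1 : 100 * Λ ≤ 2 ^ 8 * l := by rw [hΛ]; linarith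
    have h2 := Real.log_le_log (by positivity) h1
    rw [Real.log_mul (by norm_num) hl0.ne', Real.log_pow] at h2
    push_cast at h2
    linarith
  have hlΛ0 : 0 ≤ Real.log (100 * Λ) := Real.log_nonneg (by linarith)
  have hd0 : 0 < l - Real.log 2 := by linarith
  set y := Real.log (100 * Λ) / (2 * (l - Real.log 2)) with hy
  have hy0 : 0 ≤ y := by positivity
  -- `16/5` exceeds the norm bound `π + 1/40 + 1/100`. The threshold `48` is where `(16/5)(t + 6) ≤
  -- (18/5) t`; then `l > 10` absorbs the `log 2`.
  have hrate : 16 / 5 * y ≤ 2 * rate n := by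
    rw [rate, ← hldef, ← htdef, hy, ← mul_div_assoc, ← mul_div_assoc,
      div_le_div_iff₀ (by positivity) hl0]
    have : 16 / 5 * Real.log (100 * Λ) ≤ 18 / 5 * t := by linarith
    nlinarith
  have hy1 : y < 1 := by
    have := rate_le_one h3
    linarith
  have hε1 : 1 / (100 * Λ) ≤ 1 / 1000 := one_div_le_one_div_of_le (by norm_num) (by linarith)
  -- `Λ` bounds the harmonic sum, so `ε` times that sum is at most `1/100`; `y` solves `exp (-2 y (l
  -- - log 2)) = ε`.
  refine ⟨1 / (100 * Λ), y, by positivity, by linarith, hy0, hy1, ?_, ?_⟩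
  · rw [one_div, ← Real.exp_log (show 0 < (100 * Λ)⁻¹ by positivity), Real.exp_le_exp,
      Real.log_inv]
    have e : Real.log (100 * Λ) = 2 * y * (l - Real.log 2) := by
      rw [hy]
      field_simp
    rw [e]
    have := mul_le_mul_of_nonneg_left hH2 (show 0 ≤ 2 * y by positivity)
    linarith
  · refine le_trans (mul_le_mul_of_nonneg_right ?_ hy0) hrate
    have h1 : 2 * (1 / (100 * Λ)) * harm (n / 2) ≤ 1 / 50 := by
      have h2 : 2 * (1 / (100 * Λ)) * harm (n / 2) ≤ 2 * (1 / (100 * Λ)) * Λ := by gcongr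
      refine h2.trans_eq ?_
      field_simp
      norm_num
    have h2 : 2 * (1 / (100 * Λ)) * harm (n / 2) / (1 - 1 / (100 * Λ)) ≤ 1 / 40 := by
      rw [div_le_iff₀ (by linarith)]
      linarith
    have := Real.pi_lt_d2
    linarith

lemma eventually_gorinDist_le : ∀ᶠ n : ℕ in atTop, gorinDist n ≤ 2 * rate n := by
  filter_upwards [eventually_exists_params, eventually_gt_atTop 0] with n hn h0
  obtain ⟨ε, y, hε0, hε1, hy0, hy1, hy, hle⟩ := hn
  exact (gorinDist_le_of_lowPoly h0 (by omega) hε0 hε1 hy0 hy1 hy).trans hle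

lemma eventually_gorinHardyDist_le : ∀ᶠ n : ℕ in atTop, gorinHardyDist n ≤ 2 * rate n := by
  filter_upwards [eventually_exists_params, eventually_gt_atTop 0] with n hn h0
  obtain ⟨ε, y, hε0, hε1, hy0, hy1, hy, hle⟩ := hn
  exact (gorinHardyDist_le_of_lowPoly h0 (by omega) hε0 hε1 hy0 hy1 hy).trans hle

/-! ### Two-sided estimates -/

/-- For the finitely many `n` below the threshold `N`, the height bound of order `n` implies that of
order `N`, which gives `a`; the sum of the remaining ratios, added to `2`, gives `b`. -/
lemma two_sided_of_heightBound {A : ℕ → Set ℝ} (hne : ∀ n, 3 ≤ n → (A n).Nonempty)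
    (hA : ∀ n, 3 ≤ n → ∀ y ∈ A n, HeightBound n y)
    (hup : ∀ᶠ n : ℕ in atTop, sInf (A n) ≤ 2 * rate n) :
    (∃ a b : ℝ, 0 < a ∧ 0 < b ∧ ∀ n : ℕ, 3 ≤ n →
        a * rate n ≤ sInf (A n) ∧ sInf (A n) ≤ b * rate n) ∧
      (∃ n₀ : ℕ, ∀ n : ℕ, n₀ ≤ n →
        (1 / 9 : ℝ) * rate n ≤ sInf (A n) ∧ sInf (A n) ≤ 2 * rate n) := by
  obtain ⟨N, hN⟩ := eventually_atTop.1 ((eventually_rate_le.and hup).and (eventually_ge_atTop 3))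
  have hN3 : 3 ≤ N := (hN N le_rfl).2
  have hlow : ∀ n, N ≤ n → (1 / 9 : ℝ) * rate n ≤ sInf (A n) := fun n hn =>
    le_csInf (hne n (hN3.trans hn)) fun y hy => (hN n hn).1.1 y (hA n (hN3.trans hn) y hy)
  have hlow' : ∀ n, 3 ≤ n → n ≤ N → (1 / 9 : ℝ) * rate N ≤ sInf (A n) := fun n hn hnN =>
    le_csInf (hne n hn) fun y hy =>
      (hN N le_rfl).1.1 y ((hA n hn y hy).mono (by omega) hnN)
  have hrN := rate_pos hN3
  have hsum : ∀ n ∈ Finset.Icc 3 N, 0 ≤ sInf (A n) / rate n := fun n hn => by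
    obtain ⟨h3, hnN⟩ := Finset.mem_Icc.1 hn
    exact div_nonneg ((by positivity : (0 : ℝ) ≤ 1 / 9 * rate N).trans (hlow' n h3 hnN))
      (rate_pos h3).le
  refine ⟨⟨1 / 9 * rate N, 2 + ∑ n ∈ Finset.Icc 3 N, sInf (A n) / rate n, by positivity,
    add_pos_of_pos_of_nonneg two_pos (Finset.sum_nonneg hsum), fun n hn => ?_⟩,
    N, fun n hn => ⟨hlow n hn, (hN n hn).1.2⟩⟩
  have hr := rate_pos hn
  rcases le_total N n with h | h
  · constructor
    · refine le_trans ?_ (hlow n h)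
      have := mul_le_mul_of_nonneg_right (rate_le_one hN3) hr.le
      linarith
    · refine ((hN n h).1.2).trans (mul_le_mul_of_nonneg_right ?_ hr.le)
      linarith [Finset.sum_nonneg hsum]
  · constructor
    · refine le_trans ?_ (hlow' n hn h)
      exact mul_le_of_le_one_right (by positivity) (rate_le_one hn)
    · rw [← div_le_iff₀ hr]
      have := Finset.single_le_sum hsum (Finset.mem_Icc.2 ⟨hn, h⟩)
      linarith

/-- A single pole of multiplicity `n` at `ni` shows that both infima are over nonempty sets. -/
lemma norm_simpleFraction_const_le {n : ℕ} (hn : 0 < n) (x : ℝ) :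
    ‖simpleFraction (fun _ : Fin n => (n : ℂ) * Complex.I) (x : ℂ)‖ ≤ 1 := by
  have hn' : (0 : ℝ) < n := by exact_mod_cast hn
  have h1 : (n : ℝ) ≤ ‖(x : ℂ) - (n : ℂ) * Complex.I‖ := by
    have := Complex.abs_im_le_norm ((x : ℂ) - (n : ℂ) * Complex.I)
    simpa using this
  simp only [simpleFraction, Finset.sum_const, Finset.card_univ, Fintype.card_fin, nsmul_eq_mul,
    norm_mul, norm_div, norm_one, Complex.norm_natCast]
  rw [mul_one_div]
  exact div_le_one_of_le₀ h1 (norm_nonneg _)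

lemma gorinDist_two_sided :
    (∃ a b : ℝ, 0 < a ∧ 0 < b ∧ ∀ n : ℕ, 3 ≤ n →
        a * rate n ≤ gorinDist n ∧ gorinDist n ≤ b * rate n) ∧
      (∃ n₀ : ℕ, ∀ n : ℕ, n₀ ≤ n →
        (1 / 9 : ℝ) * rate n ≤ gorinDist n ∧ gorinDist n ≤ 2 * rate n) := by
  refine two_sided_of_heightBound (fun n hn => ?_) (fun n hn y hy => ?_) eventually_gorinDist_le
  · have h0 : 0 < n := by omega
    have hz : ∀ k : Fin n, ((fun _ : Fin n => (n : ℂ) * Complex.I) k).im ≠ 0 := fun k => by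
      simpa using h0.ne'
    obtain ⟨c, hc0, -, hc⟩ := exists_scale h0 hz (norm_simpleFraction_const_le h0)
    exact ⟨_, _, fun k => by simp [hc0.ne', h0.ne'], hc, rfl⟩
  · obtain ⟨z, hz, h1, rfl⟩ := hy
    exact heightBound_of_norm (by omega) hz h1.le

lemma gorinHardyDist_two_sided :
    (∃ a b : ℝ, 0 < a ∧ 0 < b ∧ ∀ n : ℕ, 3 ≤ n →
        a * rate n ≤ gorinHardyDist n ∧ gorinHardyDist n ≤ b * rate n) ∧
      (∃ n₀ : ℕ, ∀ n : ℕ, n₀ ≤ n →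
        (1 / 9 : ℝ) * rate n ≤ gorinHardyDist n ∧ gorinHardyDist n ≤ 2 * rate n) := by
  refine two_sided_of_heightBound (fun n hn => ?_) (fun n hn y hy => ?_)
    eventually_gorinHardyDist_le
  · have h0 : 0 < n := by omega
    refine ⟨_, fun _ => (n : ℂ) * Complex.I, fun k => by simpa using h0, ⟨fun _ => 0, fun _ => 0,
      ⟨differentiableOn_const _, 0, fun w _ => by simp⟩,
      Eventually.of_forall fun x _ _ => tendsto_const_nhds, ?_⟩, rfl⟩
    rw [eLpNorm_exponent_top]
    refine (eLpNormEssSup_le_of_ae_bound (C := 1) (Eventually.of_forall fun x => ?_)).trans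
      (by simp)
    simpa using norm_simpleFraction_const_le h0 x
  · obtain ⟨z, hz, ⟨f, g, hf, hg, h1⟩, rfl⟩ := hy
    exact heightBound_of_hardy (by omega) hz hf hg h1

end Gorin

end

theorem theorem2p1 :
    ((∃ a b : ℝ, 0 < a ∧ 0 < b ∧ ∀ n : ℕ, 3 ≤ n →
        a * Gorin.rate n ≤ Gorin.gorinDist n ∧ Gorin.gorinDist n ≤ b * Gorin.rate n) ∧
      (∃ n₀ : ℕ, ∀ n : ℕ, n₀ ≤ n →
        (1 / 9 : ℝ) * Gorin.rate n ≤ Gorin.gorinDist n ∧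
          Gorin.gorinDist n ≤ 2 * Gorin.rate n)) ∧
    ((∃ a b : ℝ, 0 < a ∧ 0 < b ∧ ∀ n : ℕ, 3 ≤ n →
        a * Gorin.rate n ≤ Gorin.gorinHardyDist n ∧
          Gorin.gorinHardyDist n ≤ b * Gorin.rate n) ∧
      (∃ n₀ : ℕ, ∀ n : ℕ, n₀ ≤ n →
        (1 / 9 : ℝ) * Gorin.rate n ≤ Gorin.gorinHardyDist n ∧
          Gorin.gorinHardyDist n ≤ 2 * Gorin.rate n)) := by
  exact ⟨Gorin.gorinDist_two_sided, Gorin.gorinHardyDist_two_sided⟩
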